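/- Let $\mathcal S(\mathbb R)$ be the Schwartz space. For $s\in\mathbb C$ let $\gamma_+^s=x_+^{s-1}/\Gamma(s)$ denote the tempered distribution given by $\langle\gamma_+^s,f\rangle=\frac{(-1)^k}{\Gamma(s+k)}\int_0^\infty x^{s+k-1}f^{(k)}(x)\,dx$ for any integer $k\ge 0$ with $\operatorname{Re}s+k>0$ (the value does not depend on $k$), and let ${\rm li}_s=\gamma_+^s*\mathrm{PV}\frac1{e^{-x}-1}$, that is, the tempered distribution on $\mathbb R$ given by $$\langle {\rm li}_s,f\rangle=\lim_{\epsilon\to0^+}\int_{|t|>\epsilon}\frac{\langle\gamma_+^s,f(\cdot+t)\rangle}{e^{-t}-1}\,dt,\qquad f\in\mathcal S(\mathbb R).$$ For an integer $m\ge1$ let $x^{-m}$ denote the standard (regularized) tempered distribution $$\langle x^{-m},f\rangle=\int_0^\infty x^{-m}\Bigl(f(x)+(-1)^mf(-x)-2\sum_{\substack{0\le k\le m-2\\ k\equiv m\ (2)}}\frac{x^k}{k!}f^{(k)}(0)\Bigr)dx ,$$ so that $x^{-1}=\mathrm{PV}\frac1x$. Write $T\equiv S$ if the distribution $T-S$ is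 given by a function in $C^\infty(\mathbb R)$. Then: 1. for every integer $n\ge0$, $\ {\rm li}_{-n}\equiv(-1)^{n-1}\,n!\,x^{-n-1}$; 2. for every integer $n\ge1$, $\ {\rm li}_n\equiv-\dfrac{x^{n-1}\log|x|}{(n-1)!}$, the right-hand side being the distribution given by this locally integrable function; 3. ${\rm li}_1=-\log|1-e^x|$ exactly, that is, for every $f\in\mathcal S(\mathbb R)$ the function $\log|1-e^x|\,f(x)$ is integrable and $\langle{\rm li}_1,f\rangle=-\int_{\mathbb R}\log|1-e^x|\,f(x)\,dx$. -/

import Mathlib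

open Set Filter Topology MeasureTheory
open scoped SchwartzMap ContDiff Nat

namespace Polylog

noncomputable section

/-! ### Auxiliary estimates -/

/-- A continuous seminorm on Schwartz space controlling finitely many derivatives with weights. -/
def bnd (N K : ℕ) (f : 𝓢(ℝ, ℂ)) : ℝ :=
  2 ^ N * (Finset.Iic (N, K)).sup (schwartzSeminormFamily ℂ ℝ ℂ) f

lemma bnd_nonneg (N K : ℕ) (f : 𝓢(ℝ, ℂ)) : 0 ≤ bnd N K f := by
  unfold bnd; positivity

lemma norm_iteratedDeriv_le (N K j : ℕ) (hj : j ≤ K) (f : 𝓢(ℝ, ℂ)) (x : ℝ) :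
    ‖iteratedDeriv j f x‖ ≤ bnd N K f * ((1 + |x|) ^ N)⁻¹ := by
  have h := SchwartzMap.one_add_le_sup_seminorm_apply (𝕜 := ℂ) (m := (N, K)) (k := N) (n := j)
    le_rfl hj f x
  rw [norm_iteratedFDeriv_eq_norm_iteratedDeriv, Real.norm_eq_abs] at h
  rw [← div_eq_mul_inv, le_div_iff₀' (by positivity)]
  exact h

lemma weight_integrable {σ : ℝ} {M : ℕ} (h0 : 0 < σ) (hM : σ < M) :
    IntegrableOn (fun x : ℝ => x ^ (σ - 1) * ((1 + x) ^ M)⁻¹) (Ioi 0) := by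
  have hmeas : Measurable (fun x : ℝ => x ^ (σ - 1) * ((1 + x) ^ M)⁻¹) := by fun_prop
  rw [← Ioc_union_Ioi_eq_Ioi (zero_le_one : (0 : ℝ) ≤ 1)]
  refine IntegrableOn.union ?_ ?_
  · have h1 : IntegrableOn (fun x : ℝ => x ^ (σ - 1)) (Ioc 0 1) := by
      rw [← intervalIntegrable_iff_integrableOn_Ioc_of_le zero_le_one]
      exact intervalIntegral.intervalIntegrable_rpow' (by linarith)
    refine h1.mono' hmeas.aestronglyMeasurable ?_
    filter_upwards [ae_restrict_mem measurableSet_Ioc] with x hx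
    have hx0 : 0 < x := hx.1
    have hp : 0 ≤ x ^ (σ - 1) := by positivity
    rw [Real.norm_eq_abs, abs_of_nonneg (by positivity)]
    refine mul_le_of_le_one_right hp (inv_le_one_of_one_le₀ (one_le_pow₀ (by linarith)))
  · have h1 : IntegrableOn (fun x : ℝ => x ^ (σ - 1 - M)) (Ioi 1) :=
      integrableOn_Ioi_rpow_of_lt (by linarith) one_pos
    refine h1.mono' hmeas.aestronglyMeasurable ?_
    filter_upwards [ae_restrict_mem measurableSet_Ioi] with x hx
    have hx0 : 0 < x := lt_trans one_pos hx
    rw [Real.norm_eq_abs, abs_of_nonneg (by positivity), Real.rpow_sub hx0 (σ - 1),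
      Real.rpow_natCast, div_eq_mul_inv]
    gcongr
    linarith

/-- The finite constant bounding the integrals below. -/
def wInt (σ : ℝ) (M : ℕ) : ℝ := ∫ x in Ioi (0 : ℝ), x ^ (σ - 1) * ((1 + x) ^ M)⁻¹

lemma wInt_nonneg (σ : ℝ) (M : ℕ) : 0 ≤ wInt σ M :=
  setIntegral_nonneg measurableSet_Ioi fun x hx => by
    have : 0 < x := hx
    positivity

lemma cpow_integrable {a : ℂ} {M : ℕ} (h0 : 0 < a.re) (hM : a.re < M) {h : ℝ → ℂ}
    (hc : Continuous h) {B : ℝ} (hB : ∀ x, 0 < x → ‖h x‖ ≤ B * ((1 + x) ^ M)⁻¹) :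
    IntegrableOn (fun x : ℝ => (x : ℂ) ^ (a - 1) * h x) (Ioi 0) ∧
      ‖∫ x in Ioi (0 : ℝ), (x : ℂ) ^ (a - 1) * h x‖ ≤ B * wInt a.re M := by
  have hle : ∀ᵐ x : ℝ ∂(volume.restrict (Ioi (0 : ℝ))),
      ‖(x : ℂ) ^ (a - 1) * h x‖ ≤ B * (x ^ (a.re - 1) * ((1 + x) ^ M)⁻¹) := by
    filter_upwards [ae_restrict_mem measurableSet_Ioi] with x hx
    have hx0 : 0 < x := hx
    rw [norm_mul, Complex.norm_cpow_eq_rpow_re_of_pos hx0, Complex.sub_re, Complex.one_re]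
    have hp : 0 ≤ x ^ (a.re - 1) := by positivity
    nlinarith [mul_le_mul_of_nonneg_left (hB x hx0) hp]
  have hi := (weight_integrable h0 hM).const_mul B
  refine ⟨hi.mono' ?_ hle, ?_⟩
  · have : Measurable (fun x : ℝ => (x : ℂ) ^ (a - 1) * h x) := by
      have := hc.measurable
      fun_prop
    exact this.aestronglyMeasurable
  · refine (norm_integral_le_of_norm_le hi hle).trans (le_of_eq ?_)
    rw [integral_const_mul, wInt]

/-! ### The distributions `x_+^{s-1} / Γ(s)` -/

/-- The least natural number `k` with `0 < Re s + k`. -/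
def shift (s : ℂ) : ℕ := ⌊1 - s.re⌋₊

lemma shift_pos (s : ℂ) : 0 < (s + shift s).re := by
  have := Nat.lt_floor_add_one (1 - s.re)
  simp only [Complex.add_re, Complex.natCast_re, shift]
  linarith

/-- The pairing of `γ_+^s = x_+^{s-1} / Γ(s)` with a Schwartz function. If `0 < Re s`, then `k = 0`
and this is `Γ(s)⁻¹ ∫_0^∞ x^{s-1} f(x) dx`; otherwise it is the analytic continuation in `s` of
that expression, obtained by integrating by parts `k` times. -/
def gammaPlusPairing (s : ℂ) (f : 𝓢(ℝ, ℂ)) : ℂ :=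
  (-1) ^ shift s / Complex.Gamma (s + shift s) *
    ∫ x in Ioi (0 : ℝ), (x : ℂ) ^ (s + shift s - 1) * iteratedDeriv (shift s) f x

/-- The translate `x ↦ f (x + t)`. -/
def translate (t : ℝ) (f : 𝓢(ℝ, ℂ)) : 𝓢(ℝ, ℂ) := f.compSubConstCLM ℂ (-t)

lemma translate_apply (t : ℝ) (f : 𝓢(ℝ, ℂ)) (x : ℝ) : translate t f x = f (x + t) := by
  simp [translate]

lemma iteratedDeriv_translate (n : ℕ) (t : ℝ) (f : 𝓢(ℝ, ℂ)) (x : ℝ) :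
    iteratedDeriv n (translate t f) x = iteratedDeriv n f (x + t) := by
  have h : (translate t f : ℝ → ℂ) = fun x => f (x + t) := funext fun x => translate_apply t f x
  rw [h, iteratedDeriv_comp_add_const]

lemma translate_zero (f : 𝓢(ℝ, ℂ)) : translate 0 f = f := by
  ext x; simp [translate_apply]

/-- The function `F_s(t) = ⟨γ_+^s, f(· + t)⟩`. -/
def slide (s : ℂ) (f : 𝓢(ℝ, ℂ)) (t : ℝ) : ℂ := gammaPlusPairing s (translate t f)

lemma slide_eq (s : ℂ) (f : 𝓢(ℝ, ℂ)) (t : ℝ) :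
    slide s f t = (-1) ^ shift s / Complex.Gamma (s + shift s) *
      ∫ x in Ioi (0 : ℝ), (x : ℂ) ^ (s + shift s - 1) * iteratedDeriv (shift s) f (x + t) := by
  simp only [slide, gammaPlusPairing, iteratedDeriv_translate]

lemma contDiff_iteratedDeriv (n : ℕ) (f : 𝓢(ℝ, ℂ)) : ContDiff ℝ 1 (iteratedDeriv n f) :=
  ((f.smooth ⊤).of_le (m := ((1 + n : ℕ) : ℕ∞)) (by exact_mod_cast le_top)).iterate_deriv' 1 n |>
    fun h => by simpa [iteratedDeriv_eq_iterate] using h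

lemma continuous_iteratedDeriv' (n : ℕ) (f : 𝓢(ℝ, ℂ)) : Continuous (iteratedDeriv n f) :=
  (contDiff_iteratedDeriv n f).continuous

/-- The decay exponents used in the estimates. -/
def expo (s : ℂ) : ℕ := ⌊(s + shift s).re⌋₊ + 1

lemma lt_expo (s : ℂ) : (s + shift s).re < expo s := by
  unfold expo; push_cast; exact Nat.lt_floor_add_one _

/-- The seminorm used in the estimates. -/
def nrm (s : ℂ) (f : 𝓢(ℝ, ℂ)) : ℝ := bnd (expo s + 2) (shift s + 1) f

/-- The constant used in the estimates. -/
def cst (s : ℂ) : ℝ :=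
  ‖(-1) ^ shift s / Complex.Gamma (s + shift s)‖ * wInt (s + shift s).re (expo s)

lemma cst_nonneg (s : ℂ) : 0 ≤ cst s := mul_nonneg (norm_nonneg _) (wInt_nonneg _ _)

lemma peetre {N : ℕ} {x t u : ℝ} (hx : 0 < x) (hu : |u - x| ≤ t) :
    ((1 + |u|) ^ N)⁻¹ ≤ (1 + t) ^ N * ((1 + x) ^ N)⁻¹ := by
  have ht : 0 ≤ t := (abs_nonneg _).trans hu
  rw [← div_eq_mul_inv, inv_eq_one_div, div_le_div_iff₀ (by positivity) (by positivity), one_mul,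
    ← mul_pow]
  gcongr
  have h1 : x ≤ |u| + t := by
    have := abs_le.1 hu
    have := le_abs_self u
    linarith
  nlinarith [abs_nonneg u, mul_nonneg ht (abs_nonneg u)]

lemma inv_pow_le (M : ℕ) {x : ℝ} (hx : 0 < x) : ((1 + x) ^ (M + 2))⁻¹ ≤ ((1 + x) ^ M)⁻¹ := by
  gcongr
  · linarith
  · omega

lemma slide_integrable (s : ℂ) (f : 𝓢(ℝ, ℂ)) (t : ℝ) :
    IntegrableOn (fun x : ℝ => (x : ℂ) ^ (s + shift s - 1) * iteratedDeriv (shift s) f (x + t))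
      (Ioi 0) ∧ ‖slide s f t‖ ≤ cst s * nrm s f * (1 + |t|) ^ (expo s + 2) := by
  have key := cpow_integrable (shift_pos s) (lt_expo s)
    (h := fun x => iteratedDeriv (shift s) f (x + t))
    ((continuous_iteratedDeriv' _ f).comp (by fun_prop))
    (B := nrm s f * (1 + |t|) ^ (expo s + 2)) (fun x hx => by
      refine (norm_iteratedDeriv_le (expo s + 2) (shift s + 1) _ (by omega) f _).trans ?_
      have h1 := peetre (N := expo s + 2) (x := x) (t := |t|) (u := x + t) hx (by simp)
      have h2 := inv_pow_le (expo s) hx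
      have h3 : 0 ≤ (1 + |t|) ^ (expo s + 2) := by positivity
      rw [mul_assoc]
      exact mul_le_mul_of_nonneg_left (h1.trans (mul_le_mul_of_nonneg_left h2 h3))
        (bnd_nonneg _ _ _))
  refine ⟨key.1, ?_⟩
  rw [slide_eq, norm_mul]
  refine (mul_le_mul_of_nonneg_left key.2 (norm_nonneg _)).trans (le_of_eq ?_)
  rw [cst]; ring

lemma slide_decay (s : ℂ) (f : 𝓢(ℝ, ℂ)) {t : ℝ} (ht : 0 < t) :
    ‖slide s f t‖ ≤ cst s * nrm s f * ((1 + t) ^ 2)⁻¹ := by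
  have key := cpow_integrable (shift_pos s) (lt_expo s)
    (h := fun x => iteratedDeriv (shift s) f (x + t))
    ((continuous_iteratedDeriv' _ f).comp (by fun_prop))
    (B := nrm s f * ((1 + t) ^ 2)⁻¹) (fun x hx => by
      refine (norm_iteratedDeriv_le (expo s + 2) (shift s + 1) _ (by omega) f _).trans ?_
      rw [mul_assoc]
      refine mul_le_mul_of_nonneg_left ?_ (bnd_nonneg _ _ _)
      rw [← mul_inv, abs_of_pos (by linarith), pow_add, mul_comm ((1 + (x + t)) ^ expo s)]
      gcongr <;> linarith)
  rw [slide_eq, norm_mul]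
  refine (mul_le_mul_of_nonneg_left key.2 (norm_nonneg _)).trans (le_of_eq ?_)
  rw [cst]; ring

lemma slide_sub (s : ℂ) (f : 𝓢(ℝ, ℂ)) {t : ℝ} (ht : 0 < t) :
    ‖slide s f t - slide s f (-t)‖ ≤ cst s * nrm s f * (2 * t * (1 + t) ^ (expo s + 2)) := by
  set g := iteratedDeriv (shift s) f with hg
  have hgc : Continuous g := continuous_iteratedDeriv' _ f
  have key := cpow_integrable (shift_pos s) (lt_expo s)
    (h := fun x => g (x + t) - g (x + -t))
    (by fun_prop)
    (B := nrm s f * (2 * t * (1 + t) ^ (expo s + 2))) (fun x hx => by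
      have hmv := Convex.norm_image_sub_le_of_norm_deriv_le (f := g) (s := Icc (x + -t) (x + t))
        (x := x + -t) (y := x + t)
        (C := nrm s f * ((1 + t) ^ (expo s + 2) * ((1 + x) ^ (expo s))⁻¹))
        (fun u _ => (contDiff_iteratedDeriv _ f).differentiable (by norm_num) u)
        (fun u hu => by
          rw [hg, ← iteratedDeriv_succ]
          refine (norm_iteratedDeriv_le (expo s + 2) (shift s + 1) _ le_rfl f _).trans ?_
          refine mul_le_mul_of_nonneg_left ?_ (bnd_nonneg _ _ _)
          refine (peetre hx (t := t) (abs_le.2 ⟨by linarith [hu.1], by linarith [hu.2]⟩)).trans ?_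
          exact mul_le_mul_of_nonneg_left (inv_pow_le _ hx) (by positivity))
        (convex_Icc _ _) ⟨le_rfl, by linarith⟩ ⟨by linarith, le_rfl⟩
      refine hmv.trans (le_of_eq ?_)
      rw [Real.norm_eq_abs, show x + t - (x + -t) = 2 * t by ring, abs_of_pos (by linarith)]
      ring)
  rw [slide_eq, slide_eq, ← mul_sub, ← integral_sub (slide_integrable s f t).1
    (slide_integrable s f (-t)).1, norm_mul]
  simp only [← mul_sub]
  refine (mul_le_mul_of_nonneg_left key.2 (norm_nonneg _)).trans (le_of_eq ?_)
  rw [cst]; ring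

lemma slide_measurable (s : ℂ) (f : 𝓢(ℝ, ℂ)) : StronglyMeasurable (slide s f) := by
  have : slide s f = fun t => (-1) ^ shift s / Complex.Gamma (s + shift s) *
      ∫ x in Ioi (0 : ℝ), (x : ℂ) ^ (s + shift s - 1) * iteratedDeriv (shift s) f (x + t) :=
    funext fun t => slide_eq s f t
  rw [this]
  refine StronglyMeasurable.const_mul ?_ _
  refine StronglyMeasurable.integral_prod_right
    (f := fun t x : ℝ => (x : ℂ) ^ (s + shift s - 1) * iteratedDeriv (shift s) f (x + t)) ?_
  have := (continuous_iteratedDeriv' (shift s) f).measurable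
  refine Measurable.stronglyMeasurable ?_
  simp only [Function.uncurry_def]
  fun_prop

lemma slide_add (s : ℂ) (f g : 𝓢(ℝ, ℂ)) (t : ℝ) :
    slide s (f + g) t = slide s f t + slide s g t := by
  rw [slide_eq, slide_eq, slide_eq, ← mul_add, ← integral_add (slide_integrable s f t).1
    (slide_integrable s g t).1]
  congr 2
  ext x
  rw [← mul_add]
  congr 1
  exact iteratedDeriv_add ((f.smooth _).contDiffAt) ((g.smooth _).contDiffAt)

lemma slide_smul (s : ℂ) (c : ℂ) (f : 𝓢(ℝ, ℂ)) (t : ℝ) :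
    slide s (c • f) t = c • slide s f t := by
  have h : ∀ x : ℝ, iteratedDeriv (shift s) (c • f : 𝓢(ℝ, ℂ)) x =
      c * iteratedDeriv (shift s) f x := fun x =>
    iteratedDeriv_const_smul ((f.smooth _).contDiffAt) c
  rw [slide_eq, slide_eq, smul_eq_mul]
  simp only [h, mul_left_comm _ c]
  rw [integral_const_mul, mul_left_comm]

/-- The tempered distribution `γ_+^s = x_+^{s-1} / Γ(s)`, for every complex `s`. -/
def gammaPlus (s : ℂ) : 𝓢'(ℝ, ℂ) :=
  ContinuousLinearMap.toPointwiseConvergenceCLM _ _ _ _ <|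
    SchwartzMap.mkCLMtoNormedSpace (𝕜 := ℂ) (σ := RingHom.id ℂ) (gammaPlusPairing s)
      (fun f g => by simpa [slide, translate_zero] using slide_add s f g 0)
      (fun c f => by simpa [slide, translate_zero] using slide_smul s c f 0)
      ⟨Finset.Iic (expo s + 2, shift s + 1), cst s * 2 ^ (expo s + 2),
        mul_nonneg (cst_nonneg s) (by positivity), fun f => by
          simpa [slide, translate_zero, nrm, bnd, mul_assoc] using (slide_integrable s f 0).2⟩

lemma gammaPlus_apply (s : ℂ) (f : 𝓢(ℝ, ℂ)) : gammaPlus s f = gammaPlusPairing s f := rfl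

/-! ### The polylogarithm distribution -/

/-- The principal value pairing `PV ∫ F(t) / (e^{-t} - 1) dt` of
`li_0 = PV (e^{-x} - 1)⁻¹` with a function `F`. -/
def liZeroPairing (F : ℝ → ℂ) : ℂ :=
  limUnder (𝓝[>] (0 : ℝ)) fun ε =>
    ∫ t in {t : ℝ | ε < |t|}, ((1 / (Real.exp (-t) - 1) : ℝ) : ℂ) * F t

/-- The pairing of the convolution `γ_+^s * li_0` with a Schwartz function. -/
def liPairing (s : ℂ) (f : 𝓢(ℝ, ℂ)) : ℂ :=
  liZeroPairing fun t => gammaPlus s (translate t f)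

/-- The integrand that remains after folding the principal value integral onto `(0, ∞)`. -/
def fold (s : ℂ) (f : 𝓢(ℝ, ℂ)) (t : ℝ) : ℂ :=
  ((1 / (Real.exp (-t) - 1) : ℝ) : ℂ) * slide s f t +
    ((1 / (Real.exp (- -t) - 1) : ℝ) : ℂ) * slide s f (-t)

lemma kernel_pos {t : ℝ} (ht : 0 < t) : 0 < Real.exp t - 1 := by
  have := Real.add_one_lt_exp ht.ne'
  linarith

lemma kernel_neg {t : ℝ} (ht : 0 < t) :
    1 / (Real.exp (-t) - 1) = -1 - 1 / (Real.exp t - 1) := by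
  have h1 := kernel_pos ht
  have h2 : 0 < Real.exp t := Real.exp_pos t
  have h3 : Real.exp (-t) - 1 = -((Real.exp t - 1) / Real.exp t) := by
    rw [Real.exp_neg]; field_simp; ring
  rw [h3]
  field_simp
  ring

lemma kernel_le {t : ℝ} (ht : 0 < t) : t / (Real.exp t - 1) ≤ Real.exp (-(1 / 2) * t) := by
  rw [div_le_iff₀ (kernel_pos ht)]
  have h := Real.self_le_sinh_iff.2 (by linarith : (0 : ℝ) ≤ t / 2)
  rw [Real.sinh_eq] at h
  have e1 : Real.exp (-(1 / 2) * t) * (Real.exp t - 1) =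
      Real.exp (t / 2) - Real.exp (-(t / 2)) := by
    rw [mul_sub, ← Real.exp_add]; ring_nf
  rw [e1]; linarith

lemma inv_kernel_integrable (N : ℕ) :
    IntegrableOn (fun t : ℝ => (1 + t) ^ N * Real.exp (-(1 / 2) * t)) (Ioi 0) := by
  refine integrable_of_isBigO_exp_neg (b := 1 / 4) (by norm_num) (by fun_prop) ?_
  have h := (isLittleO_pow_exp_pos_mul_atTop N (b := 1 / 4) (by norm_num)).isBigO
  have h2 : (fun t : ℝ => (1 + t) ^ N) =O[atTop] fun t => t ^ N := by
    refine Asymptotics.IsBigO.pow ?_ N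
    refine Asymptotics.IsBigO.add ?_ (Asymptotics.isBigO_refl _ _)
    exact (Asymptotics.isLittleO_const_id_atTop (1 : ℝ)).isBigO
  refine ((h2.trans h).mul (Asymptotics.isBigO_refl (fun t : ℝ => Real.exp (-(1 / 2) * t)) _)).congr
    (fun _ => rfl) (fun t => ?_)
  rw [← Real.exp_add]; ring_nf

lemma decay_integrable : IntegrableOn (fun t : ℝ => ((1 + t) ^ 2)⁻¹) (Ioi 0) := by
  have := weight_integrable (σ := 1) (M := 2) (by norm_num) (by norm_num)
  simpa using this

/-- The integrable majorant of `fold`. -/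
def major (s : ℂ) (t : ℝ) : ℝ :=
  ((1 + t) ^ 2)⁻¹ + 2 * ((1 + t) ^ (expo s + 2) * Real.exp (-(1 / 2) * t))

lemma major_integrable (s : ℂ) : IntegrableOn (major s) (Ioi 0) :=
  decay_integrable.add ((inv_kernel_integrable _).const_mul 2)

lemma fold_le (s : ℂ) (f : 𝓢(ℝ, ℂ)) {t : ℝ} (ht : 0 < t) :
    ‖fold s f t‖ ≤ cst s * nrm s f * major s t := by
  have e : fold s f t = -slide s f t -
      ((1 / (Real.exp t - 1) : ℝ) : ℂ) * (slide s f t - slide s f (-t)) := by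
    rw [fold, kernel_neg ht, neg_neg]; push_cast; ring
  have hk := kernel_pos ht
  have hcn : 0 ≤ cst s * nrm s f := mul_nonneg (cst_nonneg s) (bnd_nonneg _ _ _)
  rw [e]
  refine (norm_sub_le _ _).trans ?_
  rw [norm_neg, norm_mul, Complex.norm_real, Real.norm_eq_abs, abs_of_pos (by positivity), major,
    mul_add]
  refine add_le_add (slide_decay s f ht) ?_
  calc 1 / (Real.exp t - 1) * ‖slide s f t - slide s f (-t)‖
      ≤ 1 / (Real.exp t - 1) * (cst s * nrm s f * (2 * t * (1 + t) ^ (expo s + 2))) :=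
        mul_le_mul_of_nonneg_left (slide_sub s f ht) (by positivity)
    _ = cst s * nrm s f * (2 * (1 + t) ^ (expo s + 2)) * (t / (Real.exp t - 1)) := by
        field_simp
    _ ≤ cst s * nrm s f * (2 * (1 + t) ^ (expo s + 2)) * Real.exp (-(1 / 2) * t) :=
        mul_le_mul_of_nonneg_left (kernel_le ht) (by positivity)
    _ = _ := by ring

lemma prod_measurable (s : ℂ) (f : 𝓢(ℝ, ℂ)) :
    Measurable fun t : ℝ => ((1 / (Real.exp (-t) - 1) : ℝ) : ℂ) * slide s f t := by
  have := (slide_measurable s f).measurable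
  fun_prop

lemma fold_integrable (s : ℂ) (f : 𝓢(ℝ, ℂ)) : IntegrableOn (fold s f) (Ioi 0) := by
  refine ((major_integrable s).const_mul (cst s * nrm s f)).mono' ?_ ?_
  · have h1 := prod_measurable s f
    exact (h1.add (h1.comp measurable_neg)).aestronglyMeasurable
  · filter_upwards [ae_restrict_mem measurableSet_Ioi] with t ht using fold_le s f ht

lemma norm_integral_fold_le (s : ℂ) (f : 𝓢(ℝ, ℂ)) :
    ‖∫ t in Ioi (0 : ℝ), fold s f t‖ ≤ cst s * nrm s f * ∫ t in Ioi (0 : ℝ), major s t := by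
  rw [← integral_const_mul]
  refine norm_integral_le_of_norm_le ((major_integrable s).const_mul _) ?_
  filter_upwards [ae_restrict_mem measurableSet_Ioi] with t ht using fold_le s f ht

lemma right_integrable (s : ℂ) (f : 𝓢(ℝ, ℂ)) {ε : ℝ} (hε : 0 < ε) :
    IntegrableOn (fun t : ℝ => ((1 / (Real.exp (-t) - 1) : ℝ) : ℂ) * slide s f t) (Ioi ε) := by
  have hi : IntegrableOn (fun t : ℝ => (1 + 1 / (Real.exp ε - 1)) *
      (cst s * nrm s f * ((1 + t) ^ 2)⁻¹)) (Ioi ε) :=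
    ((decay_integrable.mono_set (Ioi_subset_Ioi hε.le)).const_mul _).const_mul _
  refine hi.mono' (prod_measurable s f).aestronglyMeasurable ?_
  filter_upwards [ae_restrict_mem measurableSet_Ioi] with t ht
  have htε : ε < t := ht
  have ht0 : 0 < t := hε.trans htε
  have h1 := kernel_pos ht0
  have h2 := kernel_pos hε
  rw [norm_mul, Complex.norm_real, Real.norm_eq_abs, kernel_neg ht0]
  refine mul_le_mul ?_ (slide_decay s f ht0) (norm_nonneg _) (by positivity)
  rw [show -1 - 1 / (Real.exp t - 1) = -(1 + 1 / (Real.exp t - 1)) by ring, abs_neg,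
    abs_of_pos (by positivity)]
  gcongr

lemma left_integrable (s : ℂ) (f : 𝓢(ℝ, ℂ)) {ε : ℝ} (hε : 0 < ε) :
    IntegrableOn (fun t : ℝ => ((1 / (Real.exp (- -t) - 1) : ℝ) : ℂ) * slide s f (-t))
      (Ioi ε) := by
  have h := (fold_integrable s f).mono_set (Ioi_subset_Ioi hε.le)
  refine (h.sub (right_integrable s f hε)).congr_fun (fun t _ => ?_) measurableSet_Ioi
  simp [fold]

lemma truncated_eq (s : ℂ) (f : 𝓢(ℝ, ℂ)) {ε : ℝ} (hε : 0 < ε) :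
    ∫ t in {t : ℝ | ε < |t|}, ((1 / (Real.exp (-t) - 1) : ℝ) : ℂ) * slide s f t =
      ∫ t in Ioi ε, fold s f t := by
  have hset : {t : ℝ | ε < |t|} = Ioi ε ∪ Iio (-ε) := by
    ext t; simp [lt_abs, lt_neg]
  have hl : IntegrableOn (fun t : ℝ => ((1 / (Real.exp (-t) - 1) : ℝ) : ℂ) * slide s f t)
      (Iio (-ε)) := by
    have := IntegrableOn.comp_neg_Iio (c := -ε) (f := fun t : ℝ =>
      ((1 / (Real.exp (- -t) - 1) : ℝ) : ℂ) * slide s f (-t))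
      (by rw [neg_neg]; exact left_integrable s f hε)
    simpa using this
  rw [hset, setIntegral_union _ measurableSet_Iio (right_integrable s f hε) hl,
    ← integral_Iic_eq_integral_Iio, ← integral_comp_neg_Ioi ε
      (fun t : ℝ => ((1 / (Real.exp (-t) - 1) : ℝ) : ℂ) * slide s f t),
    ← integral_add (right_integrable s f hε) (left_integrable s f hε)]
  · rfl
  · rw [Set.disjoint_left]
    intro t h1 h2
    have h1' : ε < t := h1
    have h2' : t < -ε := h2
    linarith

lemma tendsto_truncated (s : ℂ) (f : 𝓢(ℝ, ℂ)) :
    Tendsto (fun ε : ℝ => ∫ t in {t : ℝ | ε < |t|},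
      ((1 / (Real.exp (-t) - 1) : ℝ) : ℂ) * gammaPlus s (translate t f)) (𝓝[>] 0)
      (𝓝 (∫ t in Ioi (0 : ℝ), fold s f t)) := by
  have hcov : AECover (volume.restrict (Ioi (0 : ℝ))) (𝓝[>] (0 : ℝ)) fun ε => Ioi ε :=
    aecover_Ioi_of_Ioi (a := fun ε : ℝ => ε) (tendsto_id.mono_left nhdsWithin_le_nhds)
  have h := hcov.integral_tendsto_of_countably_generated (fold_integrable s f)
  refine h.congr' ?_
  filter_upwards [self_mem_nhdsWithin] with ε hε
  have hε' : 0 < ε := hε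
  rw [Measure.restrict_restrict measurableSet_Ioi, inter_eq_self_of_subset_left
    (Ioi_subset_Ioi hε'.le)]
  exact (truncated_eq s f hε').symm

lemma liPairing_eq (s : ℂ) (f : 𝓢(ℝ, ℂ)) : liPairing s f = ∫ t in Ioi (0 : ℝ), fold s f t :=
  (tendsto_truncated s f).limUnder_eq

/-- The tempered distribution `li_s = γ_+^s * li_0`, for every complex `s`. -/
def li (s : ℂ) : 𝓢'(ℝ, ℂ) :=
  ContinuousLinearMap.toPointwiseConvergenceCLM _ _ _ _ <|
    SchwartzMap.mkCLMtoNormedSpace (𝕜 := ℂ) (σ := RingHom.id ℂ) (liPairing s)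
      (fun f g => by
        rw [liPairing_eq, liPairing_eq, liPairing_eq, ← integral_add (fold_integrable s f)
          (fold_integrable s g)]
        refine integral_congr_ae (.of_forall fun t => ?_)
        simp only [fold, slide_add]; ring)
      (fun c f => by
        rw [liPairing_eq, liPairing_eq, RingHom.id_apply, ← integral_smul]
        refine integral_congr_ae (.of_forall fun t => ?_)
        simp only [fold, slide_smul, smul_eq_mul]; ring)
      ⟨Finset.Iic (expo s + 2, shift s + 1),
        cst s * 2 ^ (expo s + 2) * ∫ t in Ioi (0 : ℝ), major s t,
        mul_nonneg (mul_nonneg (cst_nonneg s) (by positivity))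
          (setIntegral_nonneg measurableSet_Ioi fun t ht => by
            have : 0 < t := ht
            unfold major; positivity), fun f => by
          rw [liPairing_eq]
          refine (norm_integral_fold_le s f).trans (le_of_eq ?_)
          rw [nrm, bnd]; ring⟩

lemma li_apply (s : ℂ) (f : 𝓢(ℝ, ℂ)) : li s f = liPairing s f := rfl

/-! ### The distributions `x^{-m}` -/

/-- The remainder of order `m` of the Taylor expansion of `f` at `0`. -/
def taylorRem (m : ℕ) (f : 𝓢(ℝ, ℂ)) (x : ℝ) : ℂ :=
  f x - ∑ k ∈ Finset.range m, (x : ℂ) ^ k / (k ! : ℂ) * iteratedDeriv k f 0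

/-- The standard regularization of `∫ x^{-m} f(x) dx`: the contributions of `x` and `-x` are added
and the Taylor polynomial of `f` at `0` of degree `m - 1` is subtracted. In the sum the terms of
degree `k` with `k + m` odd cancel, so that only the Taylor terms of degree `m - 2, m - 4, …` are
really subtracted, and for `m = 1` this is the principal value `∫_0^∞ (f(x) - f(-x)) / x dx`. -/
def invPowPairing (m : ℕ) (f : 𝓢(ℝ, ℂ)) : ℂ :=
  ∫ x in Ioi (0 : ℝ), (taylorRem m f x + (-1) ^ m * taylorRem m f (-x)) / (x : ℂ) ^ m

lemma taylor_bound (h : ℝ → ℂ) (hh : ContDiff ℝ ∞ h) (m : ℕ) {B : ℝ}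
    (hB : ∀ y, ‖iteratedDeriv m h y‖ ≤ B) {x : ℝ} (hx : x ∈ Ioc (0 : ℝ) 1) :
    ‖h x - ∑ k ∈ Finset.range m, (x : ℂ) ^ k / (k ! : ℂ) * iteratedDeriv k h 0‖ ≤ B * x ^ m := by
  have hB0 : 0 ≤ B := (norm_nonneg _).trans (hB 0)
  rcases m with _ | n
  · simpa using hB x
  have hud : UniqueDiffOn ℝ (Icc (0 : ℝ) 1) := uniqueDiffOn_Icc zero_lt_one
  have hw : ∀ (k : ℕ) (y : ℝ), y ∈ Icc (0 : ℝ) 1 →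
      iteratedDerivWithin k h (Icc (0 : ℝ) 1) y = iteratedDeriv k h y := fun k y hy =>
    iteratedDerivWithin_eq_iteratedDeriv hud
      ((hh.of_le (by exact_mod_cast le_top)).contDiffAt) hy
  have h1 := taylor_mean_remainder_bound (f := h) (n := n) (C := B) zero_le_one
    ((hh.of_le (by exact_mod_cast le_top)).contDiffOn) (Ioc_subset_Icc_self hx)
    (fun y hy => by rw [hw _ _ hy]; exact hB y)
  rw [taylor_within_apply, sub_zero] at h1
  have h2 : ∑ k ∈ Finset.range (n + 1), ((k ! : ℝ)⁻¹ * x ^ k) •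
      iteratedDerivWithin k h (Icc (0 : ℝ) 1) 0 =
      ∑ k ∈ Finset.range (n + 1), (x : ℂ) ^ k / (k ! : ℂ) * iteratedDeriv k h 0 := by
    refine Finset.sum_congr rfl fun k _ => ?_
    rw [hw k 0 (by simp), Complex.real_smul]
    push_cast
    ring
  rw [h2] at h1
  refine h1.trans (div_le_self (by have := hx.1; positivity) ?_)
  exact_mod_cast Nat.one_le_iff_ne_zero.2 (Nat.factorial_ne_zero n)

lemma taylorRem_le (m : ℕ) (f : 𝓢(ℝ, ℂ)) {x : ℝ} (hx : x ∈ Ioc (0 : ℝ) 1) :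
    ‖taylorRem m f x‖ ≤ bnd 2 m f * x ^ m ∧ ‖taylorRem m f (-x)‖ ≤ bnd 2 m f * x ^ m := by
  have hb : ∀ y, ‖iteratedDeriv m f y‖ ≤ bnd 2 m f := fun y =>
    (norm_iteratedDeriv_le 2 m m le_rfl f y).trans
      (mul_le_of_le_one_right (bnd_nonneg _ _ _)
        (inv_le_one_of_one_le₀ (one_le_pow₀ (by linarith [abs_nonneg y]))))
  refine ⟨taylor_bound f (f.smooth _) m hb hx, ?_⟩
  have h := taylor_bound (fun y => f (-y)) ((f.smooth _).comp contDiff_neg) m (B := bnd 2 m f)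
    (fun y => by
      rw [iteratedDeriv_comp_neg, norm_smul]
      simpa using hb (-y)) hx
  convert h using 3
  rw [taylorRem]
  refine congrArg _ (Finset.sum_congr rfl fun k _ => ?_)
  rw [iteratedDeriv_comp_neg, Complex.real_smul]
  push_cast
  rw [neg_pow, neg_zero]
  ring

lemma invPow_integrand_le_one (m : ℕ) (f : 𝓢(ℝ, ℂ)) {x : ℝ} (hx : x ∈ Ioc (0 : ℝ) 1) :
    ‖(taylorRem m f x + (-1) ^ m * taylorRem m f (-x)) / (x : ℂ) ^ m‖ ≤ 2 * bnd 2 m f := by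
  have hx0 : 0 < x := hx.1
  obtain ⟨h1, h2⟩ := taylorRem_le m f hx
  rw [norm_div, norm_pow, Complex.norm_real, Real.norm_eq_abs, abs_of_pos hx0,
    div_le_iff₀ (by positivity)]
  refine (norm_add_le _ _).trans ?_
  rw [norm_mul, norm_pow, norm_neg, norm_one, one_pow, one_mul]
  linarith

lemma invPow_integrand_le (m : ℕ) (f : 𝓢(ℝ, ℂ)) {x : ℝ} (hx : 1 < x) :
    ‖(taylorRem m f x + (-1) ^ m * taylorRem m f (-x)) / (x : ℂ) ^ m‖ ≤
      (2 + 2 * m) * bnd 2 m f * x ^ (-2 : ℝ) := by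
  have hx0 : 0 < x := one_pos.trans hx
  have hxm : 1 ≤ x ^ m := one_le_pow₀ hx.le
  have hb0 := bnd_nonneg 2 m f
  have hsup : ∀ y, |y| = x → ‖f y‖ ≤ bnd 2 m f * (x ^ 2)⁻¹ := fun y hy => by
    have h := norm_iteratedDeriv_le 2 m 0 (Nat.zero_le _) f y
    rw [iteratedDeriv_zero, hy] at h
    refine h.trans (mul_le_mul_of_nonneg_left ?_ hb0)
    gcongr
    linarith
  have hd : ∀ k ≤ m, ‖iteratedDeriv k f 0‖ ≤ bnd 2 m f := fun k hk => by
    simpa using norm_iteratedDeriv_le 2 m k hk f 0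
  have e : taylorRem m f x + (-1) ^ m * taylorRem m f (-x) = (f x + (-1) ^ m * f (-x)) -
      ∑ k ∈ Finset.range m, (1 + (-1) ^ m * (-1) ^ k) * ((x : ℂ) ^ k / (k ! : ℂ) *
        iteratedDeriv k f 0) := by
    simp only [taylorRem, mul_sub, Finset.mul_sum, add_mul, Finset.sum_add_distrib, one_mul]
    rw [sub_add_sub_comm]
    refine congrArg _ (congrArg _ (Finset.sum_congr rfl fun k _ => ?_))
    push_cast
    rw [neg_pow (x : ℂ)]
    ring
  have hterm : ∀ k ∈ Finset.range m, ‖(1 + (-1) ^ m * (-1) ^ k) * ((x : ℂ) ^ k / (k ! : ℂ) *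
        iteratedDeriv k f 0)‖ ≤ 2 * bnd 2 m f * (x ^ m * (x ^ 2)⁻¹) := fun k hk => by
    have hkm := Finset.mem_range.1 hk
    rcases Nat.lt_or_ge (k + 1) m with hlt | hge
    · have hn : ‖(1 + (-1) ^ m * (-1) ^ k : ℂ)‖ ≤ 2 := by
        refine (norm_add_le _ _).trans ?_
        simp
        norm_num
      have hf1 : (1 : ℝ) ≤ k ! := by
        exact_mod_cast Nat.one_le_iff_ne_zero.2 (Nat.factorial_ne_zero k)
      have hp : x ^ k ≤ x ^ m * (x ^ 2)⁻¹ := by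
        rw [← div_eq_mul_inv, le_div_iff₀ (by positivity), ← pow_add]
        exact pow_le_pow_right₀ hx.le (by omega)
      have hq : ‖(x : ℂ) ^ k / (k ! : ℂ)‖ ≤ x ^ m * (x ^ 2)⁻¹ := by
        rw [norm_div, norm_pow, Complex.norm_real, Real.norm_eq_abs, abs_of_pos hx0,
          Complex.norm_natCast]
        exact (div_le_self (by positivity) hf1).trans hp
      rw [norm_mul, norm_mul]
      calc _ ≤ 2 * (x ^ m * (x ^ 2)⁻¹ * bnd 2 m f) := by
            gcongr
            exact hd k hkm.le
        _ = _ := by ring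
    · have hmk : m = k + 1 := by omega
      have h0 : (1 + (-1) ^ m * (-1) ^ k : ℂ) = 0 := by
        rw [hmk, pow_succ, mul_right_comm, ← mul_pow]
        simp
      rw [h0, zero_mul, norm_zero]
      positivity
  rw [e, norm_div, norm_pow, Complex.norm_real, Real.norm_eq_abs, abs_of_pos hx0,
    div_le_iff₀ (by positivity)]
  refine (norm_sub_le _ _).trans ?_
  have h1 : ‖f x + (-1) ^ m * f (-x)‖ ≤ 2 * (bnd 2 m f * (x ^ 2)⁻¹) := by
    refine (norm_add_le _ _).trans ?_
    rw [norm_mul, norm_pow, norm_neg, norm_one, one_pow, one_mul]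
    have := hsup x (abs_of_pos hx0)
    have := hsup (-x) (by rw [abs_neg, abs_of_pos hx0])
    linarith
  have h2 := norm_sum_le_of_le (Finset.range m) hterm
  rw [Finset.sum_const, Finset.card_range, nsmul_eq_mul] at h2
  have h3 : bnd 2 m f * (x ^ 2)⁻¹ ≤ bnd 2 m f * (x ^ 2)⁻¹ * x ^ m :=
    le_mul_of_one_le_right (by positivity) hxm
  have h4 : x ^ (-2 : ℝ) = (x ^ 2)⁻¹ := by
    rw [Real.rpow_neg hx0.le]; norm_cast
  rw [h4]
  calc _ ≤ 2 * (bnd 2 m f * (x ^ 2)⁻¹ * x ^ m) + m * (2 * bnd 2 m f * (x ^ m * (x ^ 2)⁻¹)) :=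
        add_le_add (by linarith) h2
    _ = _ := by ring

lemma invPow_bound (m : ℕ) (f : 𝓢(ℝ, ℂ)) :
    IntegrableOn (fun x : ℝ => (taylorRem m f x + (-1) ^ m * taylorRem m f (-x)) / (x : ℂ) ^ m)
      (Ioi 0) ∧ ‖invPowPairing m f‖ ≤ (2 + (2 + 2 * m)) * bnd 2 m f := by
  have hm1 : Measurable (taylorRem m f) := by
    have := f.continuous.measurable
    unfold taylorRem
    fun_prop
  have hmeas : Measurable
      (fun x : ℝ => (taylorRem m f x + (-1) ^ m * taylorRem m f (-x)) / (x : ℂ) ^ m) := by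
    fun_prop
  have hi1 : IntegrableOn (fun _ : ℝ => 2 * bnd 2 m f) (Ioc (0 : ℝ) 1) := by
    exact integrableOn_const (by simp) enorm_ne_top
  have hi2 : IntegrableOn (fun x : ℝ => (2 + 2 * m) * bnd 2 m f * x ^ (-2 : ℝ)) (Ioi (1 : ℝ)) :=
    (integrableOn_Ioi_rpow_of_lt (by norm_num) one_pos).const_mul _
  have hb1 : ∀ᵐ x : ℝ ∂(volume.restrict (Ioc (0 : ℝ) 1)),
      ‖(taylorRem m f x + (-1) ^ m * taylorRem m f (-x)) / (x : ℂ) ^ m‖ ≤ 2 * bnd 2 m f := by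
    filter_upwards [ae_restrict_mem measurableSet_Ioc] with x hx
      using invPow_integrand_le_one m f hx
  have hb2 : ∀ᵐ x : ℝ ∂(volume.restrict (Ioi (1 : ℝ))),
      ‖(taylorRem m f x + (-1) ^ m * taylorRem m f (-x)) / (x : ℂ) ^ m‖ ≤
        (2 + 2 * m) * bnd 2 m f * x ^ (-2 : ℝ) := by
    filter_upwards [ae_restrict_mem measurableSet_Ioi] with x hx
      using invPow_integrand_le m f hx
  have hI1 := hi1.mono' hmeas.aestronglyMeasurable hb1
  have hI2 := hi2.mono' hmeas.aestronglyMeasurable hb2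
  have hu : Ioc (0 : ℝ) 1 ∪ Ioi 1 = Ioi 0 := Ioc_union_Ioi_eq_Ioi zero_le_one
  refine ⟨hu ▸ IntegrableOn.union hI1 hI2, ?_⟩
  rw [invPowPairing, ← hu, setIntegral_union _ measurableSet_Ioi hI1 hI2, add_mul]
  · refine (norm_add_le _ _).trans (add_le_add ?_ ?_)
    · refine (norm_integral_le_of_norm_le hi1 hb1).trans (le_of_eq ?_)
      simp
    · refine (norm_integral_le_of_norm_le hi2 hb2).trans (le_of_eq ?_)
      rw [integral_const_mul, integral_Ioi_rpow_of_lt (by norm_num) one_pos]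
      norm_num
  · rw [Set.disjoint_left]
    intro x h1 h2
    exact absurd h1.2 (not_le.2 h2)

lemma taylorRem_add (m : ℕ) (f g : 𝓢(ℝ, ℂ)) (x : ℝ) :
    taylorRem m (f + g) x = taylorRem m f x + taylorRem m g x := by
  have h : ∀ k : ℕ, iteratedDeriv k (f + g : 𝓢(ℝ, ℂ)) 0 =
      iteratedDeriv k f 0 + iteratedDeriv k g 0 := fun k =>
    iteratedDeriv_add ((f.smooth _).contDiffAt) ((g.smooth _).contDiffAt)
  simp only [taylorRem, h, mul_add, Finset.sum_add_distrib]
  rw [add_apply]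
  ring

lemma taylorRem_smul (m : ℕ) (c : ℂ) (f : 𝓢(ℝ, ℂ)) (x : ℝ) :
    taylorRem m (c • f) x = c * taylorRem m f x := by
  have h : ∀ k : ℕ, iteratedDeriv k (c • f : 𝓢(ℝ, ℂ)) 0 = c * iteratedDeriv k f 0 := fun k =>
    iteratedDeriv_const_smul ((f.smooth _).contDiffAt) c
  simp only [taylorRem, h, mul_sub, Finset.mul_sum, mul_left_comm c]
  rfl

/-- The tempered distribution `x^{-m}` on the real line. -/
def invPow (m : ℕ) : 𝓢'(ℝ, ℂ) :=
  ContinuousLinearMap.toPointwiseConvergenceCLM _ _ _ _ <|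
    SchwartzMap.mkCLMtoNormedSpace (𝕜 := ℂ) (σ := RingHom.id ℂ) (invPowPairing m)
      (fun f g => by
        simp only [invPowPairing]
        rw [← integral_add (invPow_bound m f).1 (invPow_bound m g).1]
        refine integral_congr_ae (.of_forall fun x => ?_)
        simp only [taylorRem_add]; ring)
      (fun c f => by
        simp only [invPowPairing, RingHom.id_apply]
        rw [← integral_smul]
        refine integral_congr_ae (.of_forall fun x => ?_)
        simp only [taylorRem_smul, smul_eq_mul]; ring)
      ⟨Finset.Iic (2, m), (2 + (2 + 2 * m)) * 2 ^ 2, by positivity, fun f => by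
        refine (invPow_bound m f).2.trans (le_of_eq ?_)
        rw [bnd]; ring⟩

lemma invPow_apply (m : ℕ) (f : 𝓢(ℝ, ℂ)) : invPow m f = invPowPairing m f := rfl

/-! ### Distributions given by functions -/

/-- The tempered distribution `T` is given by the locally integrable function `h`: its value on
every compactly supported test function `f` is `∫ h f`. -/
def IsGivenBy (T : 𝓢'(ℝ, ℂ)) (h : ℝ → ℂ) : Prop :=
  LocallyIntegrable h ∧
    ∀ f : 𝓢(ℝ, ℂ), HasCompactSupport f → T f = ∫ x, h x * f x

end
end Polylog

namespace Polylog

noncomputable section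

/-! ### Derivatives of the distributions -/

/-! Everything reduces to two base cases by differentiation. Since the derivative of `γ_+^s` is
`γ_+^{s-1}`, convolution gives `li_s' = li_{s-1}` (`li_D`), while `(x^{-m})' = -m x^{-m-1}`
(`invPow_D`).

Negative orders: `γ_+^0` is the Dirac mass, so `li_0 = PV 1/(e^{-x}-1)`. The function `1/(e^{-x}-1)
+ 1/x` extends smoothly over the origin (`pvRem`), which settles `n = 0`; differentiating `n` times
turns `-x^{-1}` into `(-1)^{n-1} n! x^{-n-1}` and keeps the remainder smooth.

Positive orders: `γ_+^1` is the Heaviside function and `-log|1-e^x|` is a primitive of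
`1/(e^{-x}-1)` away from `0`. An integration by parts with vanishing boundary terms gives the exact
formula `li_one`. Writing `1 - e^x = -x q(x)` with `q = (e^x-1)/x` positive and analytic splits off
`-log|x|`. Higher orders follow by taking primitives: a distribution is determined by its derivative
up to a constant (`IsGivenBy.exists_antideriv`), and constants are smooth. -/

/-- Only a one-sided limit is required at `a`, because the primitives used below contain `log` or
`x^{-m}` and are singular at the endpoint. It is integration by parts against the constant `1`. -/
lemma integral_Ioi_of_tendsto_nhdsGT {G G' : ℝ → ℂ} {a : ℝ} {l m : ℂ}
    (hderiv : ∀ x ∈ Ioi a, HasDerivAt G (G' x) x) (hint : IntegrableOn G' (Ioi a))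
    (hl : Tendsto G (𝓝[>] a) (𝓝 l)) (hm : Tendsto G atTop (𝓝 m)) :
    ∫ x in Ioi a, G' x = m - l := by
  have h := integral_Ioi_deriv_mul_eq_sub (u := G) (u' := G') (v := fun _ => (1 : ℂ))
    (v' := fun _ => 0) (a := a) (a' := l) (b' := m) hderiv (fun x _ => hasDerivAt_const x 1)
    (hint.congr_fun (fun x _ => by simp) measurableSet_Ioi)
    (hl.congr fun x => by simp) (hm.congr fun x => by simp)
  simpa using h

/-- The derivative of a Schwartz function, as a Schwartz function. -/
abbrev D (f : 𝓢(ℝ, ℂ)) : 𝓢(ℝ, ℂ) := SchwartzMap.derivCLM ℂ ℂ f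

lemma coe_D (f : 𝓢(ℝ, ℂ)) : (D f : ℝ → ℂ) = deriv f := rfl

lemma hasDerivAt_D (f : 𝓢(ℝ, ℂ)) (x : ℝ) : HasDerivAt f (D f x) x := f.hasDerivAt x

lemma iteratedDeriv_D (n : ℕ) (f : 𝓢(ℝ, ℂ)) :
    iteratedDeriv n (D f) = iteratedDeriv (n + 1) f := by
  rw [iteratedDeriv_succ', coe_D]

lemma shift_of_one_lt {s : ℂ} (hs : 1 < s.re) : shift s = 0 := by
  rw [shift, Nat.floor_eq_zero]; linarith

lemma shift_sub_one_of_one_lt {s : ℂ} (hs : 1 < s.re) : shift (s - 1) = 0 := by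
  rw [shift, Nat.floor_eq_zero, Complex.sub_re, Complex.one_re]; linarith

lemma shift_sub_one_of_le_one {s : ℂ} (hs : s.re ≤ 1) : shift (s - 1) = shift s + 1 := by
  rw [shift, shift, ← Nat.floor_add_one (by linarith), Complex.sub_re, Complex.one_re]
  congr 1
  ring

/-- Lowering `s` by one raises the shift by one, so both pairings contain the same power of `x` and
the same derivative of `f`; only the sign `(-1)^k` changes. -/
lemma slide_D_of_le_one {s : ℂ} (hs : s.re ≤ 1) (f : 𝓢(ℝ, ℂ)) (t : ℝ) :
    slide s (D f) t = -slide (s - 1) f t := by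
  have e : s - 1 + ((shift s + 1 : ℕ) : ℂ) = s + shift s := by push_cast; ring
  rw [slide_eq, slide_eq, shift_sub_one_of_le_one hs, e, iteratedDeriv_D, pow_succ]
  ring

/-- Here both shifts vanish, so a genuine integration by parts is needed, combined with `Γ(s) =
(s-1) Γ(s-1)`. -/
lemma slide_D_of_one_lt {s : ℂ} (hs : 1 < s.re) (f : 𝓢(ℝ, ℂ)) (t : ℝ) :
    slide s (D f) t = -slide (s - 1) f t := by
  have h0 := shift_of_one_lt hs
  have h1 := shift_sub_one_of_one_lt hs
  have hs1 : 0 < (s - 1).re := by simp [hs]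
  have hne : s - 1 ≠ 0 := fun h => by simp [h] at hs1
  have i1 := (slide_integrable s f t).1
  have i2 := (slide_integrable s (D f) t).1
  have i3 := (slide_integrable (s - 1) f t).1
  rw [slide_eq, slide_eq]
  simp only [h0, h1, Nat.cast_zero, add_zero, iteratedDeriv_zero, pow_zero] at i1 i2 i3 ⊢
  have hu : ∀ x ∈ Ioi (0 : ℝ), HasDerivAt (fun x : ℝ => (x : ℂ) ^ (s - 1))
      ((s - 1) * (x : ℂ) ^ (s - 1 - 1)) x := fun x hx =>
    hasDerivAt_ofReal_cpow_const (ne_of_gt hx) hne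
  have hv : ∀ x ∈ Ioi (0 : ℝ), HasDerivAt (fun x : ℝ => f (x + t)) (D f (x + t)) x := fun x _ =>
    (hasDerivAt_D f (x + t)).comp_add_const x t
  have i3' : IntegrableOn (fun x : ℝ => (s - 1) * (x : ℂ) ^ (s - 1 - 1) * f (x + t)) (Ioi 0) :=
    IntegrableOn.congr_fun (i3.const_mul (s - 1)) (fun x _ => by simp only [mul_assoc])
      measurableSet_Ioi
  have hz : Tendsto (fun x : ℝ => (x : ℂ) ^ (s - 1) * f (x + t)) (𝓝[>] 0) (𝓝 0) := by
    have hc : Continuous fun x : ℝ => (x : ℂ) ^ (s - 1) * f (x + t) :=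
      (Complex.continuous_ofReal_cpow_const hs1).mul (f.continuous.comp (by fun_prop))
    have := hc.tendsto 0
    rw [Complex.ofReal_zero, Complex.zero_cpow hne, zero_mul] at this
    exact this.mono_left nhdsWithin_le_nhds
  -- The boundary term at infinity vanishes because the product and its derivative are both
  -- integrable.
  have hi := tendsto_zero_of_hasDerivAt_of_integrableOn_Ioi (fun x hx => (hu x hx).mul (hv x hx))
    (i3'.add i2) i1
  have key := integral_Ioi_mul_deriv_eq_deriv_mul hu hv i2 i3' hz hi
  have hG : Complex.Gamma s = (s - 1) * Complex.Gamma (s - 1) := by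
    have := Complex.Gamma_add_one (s - 1) hne
    rwa [sub_add_cancel] at this
  have hGne := Complex.Gamma_ne_zero_of_re_pos hs1
  simp only [mul_assoc] at key
  rw [key, integral_const_mul, hG]
  field_simp
  ring

lemma slide_D (s : ℂ) (f : 𝓢(ℝ, ℂ)) (t : ℝ) : slide s (D f) t = -slide (s - 1) f t :=
  (le_or_gt s.re 1).elim (slide_D_of_le_one · f t) (slide_D_of_one_lt · f t)

/-- `li_{s-1}` is the distributional derivative of `li_s`. -/
lemma li_D (s : ℂ) (f : 𝓢(ℝ, ℂ)) : li s (D f) = -li (s - 1) f := by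
  rw [li_apply, li_apply, liPairing_eq, liPairing_eq, ← integral_neg]
  congr 1
  ext t
  simp only [fold, slide_D]
  ring

/-! ### The Heaviside function and the Dirac mass as `γ_+^1` and `γ_+^0`. -/

lemma slide_one (f : 𝓢(ℝ, ℂ)) (t : ℝ) : slide 1 f t = ∫ x in Ioi t, f x := by
  have h0 : shift 1 = 0 := by simp [shift]
  rw [slide_eq]
  simp only [h0, Nat.cast_zero, add_zero, sub_self, Complex.cpow_zero, one_mul, iteratedDeriv_zero,
    Complex.Gamma_one, pow_zero, div_one]
  have h := (measurePreserving_add_right volume t).setIntegral_preimage_emb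
    (measurableEmbedding_addRight t) f (Ioi t)
  simpa using h

lemma tendsto_atTop_zero (f : 𝓢(ℝ, ℂ)) : Tendsto f atTop (𝓝 0) :=
  (f.toZeroAtInfty.zero_at_infty').mono_left atTop_le_cocompact

/-- The Dirac mass is the derivative of the Heaviside function: this is `slide_D` at `s = 1`. -/
lemma slide_zero (f : 𝓢(ℝ, ℂ)) (t : ℝ) : slide 0 f t = f t := by
  have h := slide_D 1 f t
  rw [sub_self, slide_one, integral_Ioi_of_hasDerivAt_of_tendsto' (f := f) (m := 0)
    (fun x _ => hasDerivAt_D f x) (D f).integrable.integrableOn (tendsto_atTop_zero f),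
    zero_sub] at h
  exact (neg_injective h).symm

lemma hasDerivAt_slide_one (f : 𝓢(ℝ, ℂ)) (t : ℝ) : HasDerivAt (slide 1 f) (-f t) t := by
  have e : slide 1 f = fun t => (∫ x in Ioi (0 : ℝ), f x) - ∫ x in (0 : ℝ)..t, f x := by
    ext t
    rw [slide_one, eq_sub_iff_add_eq, add_comm,
      intervalIntegral.integral_interval_add_Ioi f.integrable.integrableOn
        f.integrable.integrableOn]
  rw [e]
  exact (intervalIntegral.integral_hasDerivAt_right (f.continuous.intervalIntegrable _ _)
    (f.continuous.stronglyMeasurableAtFilter _ _) f.continuous.continuousAt).const_sub _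

lemma norm_slide_one_le (f : 𝓢(ℝ, ℂ)) (t : ℝ) : ‖slide 1 f t‖ ≤ ∫ x, ‖f x‖ := by
  rw [slide_one]
  exact (norm_integral_le_integral_norm _).trans
    (setIntegral_le_integral f.integrable.norm (.of_forall fun _ => norm_nonneg _))

/-! ### Taylor remainders and the derivative of `x^{-m}`. -/

lemma hasDerivAt_taylorRem (m : ℕ) (f : 𝓢(ℝ, ℂ)) (x : ℝ) :
    HasDerivAt (taylorRem (m + 1) f) (taylorRem m (D f) x) x := by
  have hp : ∀ k ∈ Finset.range m, HasDerivAt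
      (fun x : ℝ => (x : ℂ) ^ (k + 1) / ((k + 1)! : ℂ) * iteratedDeriv (k + 1) f 0)
      ((x : ℂ) ^ k / (k ! : ℂ) * iteratedDeriv k (D f) 0) x := fun k _ => by
    have h := (((hasDerivAt_id x).ofReal_comp.pow (k + 1)).div_const ((k + 1)! : ℂ)).mul_const
      (iteratedDeriv (k + 1) f 0)
    refine h.congr_deriv ?_
    have h1 : (k ! : ℂ) ≠ 0 := by exact_mod_cast Nat.factorial_ne_zero k
    have h2 : (k : ℂ) + 1 ≠ 0 := Nat.cast_add_one_ne_zero k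
    rw [iteratedDeriv_D, Nat.factorial_succ]
    push_cast
    simp only [id]
    field_simp
  have h := (hasDerivAt_D f x).sub ((HasDerivAt.fun_sum hp).add_const (f 0))
  refine h.congr_of_eventuallyEq (.of_forall fun y => ?_)
  simp [taylorRem, Finset.sum_range_succ']

/-- In norm the boundary term is `x` times the integrand of `invPowPairing (m + 1)`, which is
bounded near `0` and `O(x^{-2})` at infinity. -/
lemma tendsto_invPow_boundary (m : ℕ) (f : 𝓢(ℝ, ℂ)) :
    Tendsto (fun x : ℝ => ((x : ℂ) ^ m)⁻¹ * (taylorRem (m + 1) f x +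
      (-1) ^ (m + 1) * taylorRem (m + 1) f (-x))) (𝓝[>] 0) (𝓝 0) ∧
    Tendsto (fun x : ℝ => ((x : ℂ) ^ m)⁻¹ * (taylorRem (m + 1) f x +
      (-1) ^ (m + 1) * taylorRem (m + 1) f (-x))) atTop (𝓝 0) := by
  have hn : ∀ x : ℝ, 0 < x → ‖((x : ℂ) ^ m)⁻¹ * (taylorRem (m + 1) f x +
      (-1) ^ (m + 1) * taylorRem (m + 1) f (-x))‖ = x * ‖(taylorRem (m + 1) f x +
      (-1) ^ (m + 1) * taylorRem (m + 1) f (-x)) / (x : ℂ) ^ (m + 1)‖ := fun x hx => by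
    rw [norm_mul, norm_div, norm_inv, norm_pow, norm_pow, Complex.norm_real, Real.norm_eq_abs,
      abs_of_pos hx]
    field_simp
    ring
  constructor
  · refine squeeze_zero_norm' (a := fun x : ℝ => x * (2 * bnd 2 (m + 1) f)) ?_ ?_
    · filter_upwards [Ioc_mem_nhdsGT (zero_lt_one (α := ℝ))] with x hx
      rw [hn x hx.1]
      exact mul_le_mul_of_nonneg_left (invPow_integrand_le_one _ f hx) hx.1.le
    · have : Continuous fun x : ℝ => x * (2 * bnd 2 (m + 1) f) := by fun_prop
      simpa using (this.tendsto 0).mono_left nhdsWithin_le_nhds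
  · refine squeeze_zero_norm'
      (a := fun x : ℝ => (2 + 2 * (m + 1 : ℕ)) * bnd 2 (m + 1) f * x⁻¹) ?_ ?_
    · filter_upwards [Ioi_mem_atTop (1 : ℝ)] with x hx
      have hx0 : 0 < x := one_pos.trans hx
      rw [hn x hx0]
      refine (mul_le_mul_of_nonneg_left (invPow_integrand_le _ f hx) hx0.le).trans (le_of_eq ?_)
      rw [Real.rpow_neg hx0.le, Real.rpow_ofNat]
      field_simp
    · simpa using tendsto_inv_atTop_zero.const_mul ((2 + 2 * (m + 1 : ℕ)) * bnd 2 (m + 1) f)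

/-- The distributional derivative of `x^{-m}` is `-m x^{-m-1}`. -/
lemma invPow_D (m : ℕ) (f : 𝓢(ℝ, ℂ)) : invPow m (D f) = m * invPow (m + 1) f := by
  have i1 := (invPow_bound m (D f)).1
  have i2 := (invPow_bound (m + 1) f).1
  obtain ⟨hz, hi⟩ := tendsto_invPow_boundary m f
  -- `G'` is the derivative of the boundary term above. The reflection `x ↦ -x` contributes the sign
  -- that turns `(-1)^(m+1)` into `(-1)^m`.
  have h := integral_Ioi_of_tendsto_nhdsGT (G' := fun x : ℝ =>
      (taylorRem m (D f) x + (-1) ^ m * taylorRem m (D f) (-x)) / (x : ℂ) ^ m -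
      m * ((taylorRem (m + 1) f x + (-1) ^ (m + 1) * taylorRem (m + 1) f (-x)) /
        (x : ℂ) ^ (m + 1))) (fun x hx => ?_) (i1.sub (i2.const_mul _)) hz hi
  · rw [integral_sub i1 (i2.const_mul _), integral_const_mul, sub_zero] at h
    exact sub_eq_zero.1 h
  · have hx0 : (x : ℂ) ≠ 0 := by exact_mod_cast (ne_of_gt hx : x ≠ 0)
    have h1 := ((hasDerivAt_id x).ofReal_comp.pow m).inv (pow_ne_zero m hx0)
    have h2 := (hasDerivAt_taylorRem m f x).add
      (((hasDerivAt_taylorRem m f (-x)).scomp x (hasDerivAt_neg x)).const_mul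
        ((-1 : ℂ) ^ (m + 1)))
    refine (h1.mul h2).congr_deriv ?_
    -- The derivative of `x^m` carries the truncated exponent `m - 1`, so `m = 0` is treated apart.
    rcases m with _ | m
    · simp
    · simp only [id, Complex.real_smul, Function.comp, Pi.inv_apply, Pi.pow_apply, Pi.add_apply]
      rw [add_tsub_cancel_right]
      push_cast
      field_simp
      ring


/-! ### Analytic quotients of the exponential -/

/-- At `0` the power series of `f` is shifted by one degree; elsewhere this is an ordinary quotient.
-/
lemma analyticAt_dslope_zero {f : ℝ → ℝ} (hf : ∀ x, AnalyticAt ℝ f x) (x : ℝ) :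
    AnalyticAt ℝ (dslope f 0) x := by
  rcases eq_or_ne x 0 with rfl | hx
  · obtain ⟨p, hp⟩ := hf 0
    exact hp.has_fpower_series_dslope_fslope.analyticAt
  · have h : AnalyticAt ℝ (fun y => (f y - f 0) / y) x :=
      ((hf x).sub analyticAt_const).div analyticAt_id hx
    refine h.congr ?_
    filter_upwards [isOpen_ne.mem_nhds hx] with y hy
    rw [dslope_of_ne _ hy, slope_def_field, sub_zero]

/-- The entire function `(e^x - 1) / x`. -/
def expQuot : ℝ → ℝ := dslope Real.exp 0

lemma analyticAt_expQuot (x : ℝ) : AnalyticAt ℝ expQuot x :=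
  analyticAt_dslope_zero (fun _ => analyticAt_rexp) x

lemma expQuot_zero : expQuot 0 = 1 := by simp [expQuot, dslope_same]

lemma mul_expQuot (x : ℝ) : x * expQuot x = Real.exp x - 1 := by
  have := sub_smul_dslope Real.exp 0 x
  simpa [expQuot] using this

lemma exp_sub_one_le (x : ℝ) : Real.exp x - 1 ≤ x * Real.exp x := by
  have h := mul_le_mul_of_nonneg_left (Real.add_one_le_exp (-x)) (Real.exp_pos x).le
  rw [← Real.exp_add, add_neg_cancel, Real.exp_zero] at h
  linarith

/-- From `x ≤ e^x - 1 ≤ x e^x` the quotient lies between `1` and `e^x`. The symmetric form gives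
positivity and the linear bound on its logarithm. -/
lemma expQuot_bounds (x : ℝ) :
    Real.exp (-|x|) ≤ expQuot x ∧ expQuot x ≤ Real.exp |x| := by
  have h1 := mul_expQuot x
  have h2 := exp_sub_one_le x
  have h3 := Real.add_one_le_exp x
  rcases lt_trichotomy x 0 with hx | rfl | hx
  · rw [abs_of_neg hx, neg_neg]
    have h4 : 1 ≤ Real.exp (-x) := Real.one_le_exp (by linarith)
    exact ⟨by nlinarith, by nlinarith⟩
  · simp [expQuot_zero]
  · rw [abs_of_pos hx]
    have h4 : Real.exp (-x) ≤ 1 := Real.exp_le_one_iff.2 (by linarith)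
    exact ⟨by nlinarith, by nlinarith⟩

lemma expQuot_pos (x : ℝ) : 0 < expQuot x := (Real.exp_pos _).trans_le (expQuot_bounds x).1

lemma abs_log_expQuot_le (x : ℝ) : |Real.log (expQuot x)| ≤ |x| := by
  obtain ⟨h1, h2⟩ := expQuot_bounds x
  exact abs_le.2 ⟨(Real.le_log_iff_exp_le (expQuot_pos x)).2 h1,
    (Real.log_le_iff_le_exp (expQuot_pos x)).2 h2⟩

lemma log_abs_one_sub_exp (x : ℝ) :
    Real.log |1 - Real.exp x| = Real.log |x| + Real.log (expQuot x) := by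
  rw [abs_sub_comm, ← mul_expQuot, abs_mul, abs_of_pos (expQuot_pos x)]
  -- At the origin both sides vanish by the convention `Real.log 0 = 0`.
  rcases eq_or_ne x 0 with rfl | hx
  · simp [expQuot_zero]
  · exact Real.log_mul (abs_ne_zero.2 hx) (expQuot_pos x).ne'

lemma contDiff_log_expQuot : ContDiff ℝ ∞ fun x => Real.log (expQuot x) :=
  contDiff_iff_contDiffAt.2 fun x => (analyticAt_expQuot x).contDiffAt.log (expQuot_pos x).ne'

/-- The smooth function that agrees with `1 / (e^{-x} - 1) + 1 / x` away from zero. -/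
def pvRem (x : ℝ) : ℝ := -dslope expQuot 0 (-x) / expQuot (-x)

lemma contDiff_pvRem : ContDiff ℝ ∞ pvRem := by
  have h : ContDiff ℝ ∞ fun x => -dslope expQuot 0 x / expQuot x :=
    contDiff_iff_contDiffAt.2 fun x =>
      ((analyticAt_dslope_zero analyticAt_expQuot x).contDiffAt.neg).div
        (analyticAt_expQuot x).contDiffAt (expQuot_pos x).ne'
  exact h.comp contDiff_neg

/-- With `y = -x` and `q = expQuot y`, one has `1/(y q) - 1/y = -((q - 1)/y)/q`, and `(q - 1)/y` is
again a divided difference at `0`. -/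
lemma pvRem_of_ne {x : ℝ} (hx : x ≠ 0) : pvRem x = 1 / (Real.exp (-x) - 1) + 1 / x := by
  have h1 := mul_expQuot (-x)
  have h2 := sub_smul_dslope expQuot 0 (-x)
  have h3 := (expQuot_pos (-x)).ne'
  rw [expQuot_zero, sub_zero, smul_eq_mul] at h2
  rw [pvRem, ← h1, show dslope expQuot 0 (-x) = (expQuot (-x) - 1) / (-x) by
    rw [← h2]; field_simp]
  field_simp
  ring

/-! ### The logarithmic kernel of `li_1` -/

lemma integral_eq_integral_Ioi_add_neg {p : ℝ → ℂ} (hp : Integrable p) :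
    ∫ x, p x = ∫ x in Ioi (0 : ℝ), (p x + p (-x)) := by
  have hn : Integrable fun x => p (-x) := hp.comp_neg
  rw [integral_add hp.integrableOn hn.integrableOn, integral_comp_neg_Ioi, neg_zero, add_comm,
    intervalIntegral.integral_Iic_add_Ioi hp.integrableOn hp.integrableOn]

/-- The function `-log |1 - e^x|`. -/
def logKernel (x : ℝ) : ℝ := -Real.log |1 - Real.exp x|

lemma measurable_logKernel : Measurable logKernel := by unfold logKernel; fun_prop

lemma abs_logKernel_le (x : ℝ) : |logKernel x| ≤ |Real.log x| + |x| := by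
  rw [logKernel, abs_neg, log_abs_one_sub_exp, Real.log_abs]
  exact (abs_add_le _ _).trans (add_le_add le_rfl (abs_log_expQuot_le x))

/-- The logarithm is split into an integrable part near `0` and a part of linear growth, which
Schwartz decay absorbs. -/
lemma abs_log_le_indicator_add (x : ℝ) :
    |Real.log x| ≤ (Icc (-1) 1).indicator (fun y => |Real.log y|) x + |x| := by
  by_cases hx : x ∈ Icc (-1 : ℝ) 1
  · rw [indicator_of_mem hx]
    linarith [abs_nonneg x]
  · rw [indicator_of_notMem hx, zero_add, ← Real.log_abs]
    have h1 : 1 < |x| := by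
      by_contra! h
      exact hx (abs_le.1 h)
    rw [abs_of_nonneg (Real.log_nonneg h1.le)]
    exact Real.log_le_self (by linarith)

lemma integrable_indicator_abs_log :
    Integrable ((Icc (-1) 1).indicator fun y : ℝ => |Real.log y|) := by
  rw [integrable_indicator_iff measurableSet_Icc, integrableOn_Icc_iff_integrableOn_Ioc,
    ← intervalIntegrable_iff_integrableOn_Ioc_of_le (by norm_num)]
  exact intervalIntegral.intervalIntegrable_log'.abs

lemma integrable_logKernel_mul (f : 𝓢(ℝ, ℂ)) :
    Integrable fun x : ℝ => ((logKernel x : ℝ) : ℂ) * f x := by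
  have h1 := integrable_indicator_abs_log.const_mul (bnd 0 0 f)
  have h2 := (f.integrable_pow_mul volume 1).const_mul 2
  refine (h1.add h2).mono' ?_ (.of_forall fun x => ?_)
  · have := measurable_logKernel
    have := f.continuous.measurable
    exact Measurable.aestronglyMeasurable (by fun_prop)
  · have hb : ‖f x‖ ≤ bnd 0 0 f := by simpa using norm_iteratedDeriv_le 0 0 0 le_rfl f x
    have hi : 0 ≤ (Icc (-1) 1).indicator (fun y : ℝ => |Real.log y|) x :=
      indicator_nonneg (fun _ _ => abs_nonneg _) x
    have h3 := abs_logKernel_le x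
    have h4 := abs_log_le_indicator_add x
    rw [norm_mul, Complex.norm_real, Real.norm_eq_abs]
    simp only [Pi.add_apply, pow_one, Real.norm_eq_abs]
    calc |logKernel x| * ‖f x‖
        ≤ ((Icc (-1) 1).indicator (fun y => |Real.log y|) x + 2 * |x|) * ‖f x‖ := by
          gcongr; linarith
      _ ≤ _ := by nlinarith [mul_le_mul_of_nonneg_left hb hi]

lemma hasDerivAt_logKernel {x : ℝ} (hx : x ≠ 0) :
    HasDerivAt logKernel (1 / (Real.exp (-x) - 1)) x := by
  have hne : 1 - Real.exp x ≠ 0 := fun h => hx (Real.exp_eq_one_iff x |>.1 (by linarith))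
  have h := (((Real.hasDerivAt_exp x).const_sub 1).log hne).neg
  rw [show logKernel = fun x => -Real.log (1 - Real.exp x) from
    funext fun x => by rw [logKernel, Real.log_abs]]
  refine h.congr_deriv ?_
  have h2 : Real.exp x ≠ 0 := (Real.exp_pos x).ne'
  rw [Real.exp_neg, show (Real.exp x)⁻¹ - 1 = (1 - Real.exp x) / Real.exp x by field_simp]
  field_simp

lemma logKernel_of_pos {x : ℝ} (hx : 0 < x) : logKernel x = -Real.log (Real.exp x - 1) := by
  rw [logKernel, abs_sub_comm, abs_of_pos (kernel_pos hx)]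

/-- This comes from `1 - e^{-x} = (e^x - 1) e^{-x}` and lets the boundary terms at `x` and `-x` be
compared. -/
lemma logKernel_neg {x : ℝ} (hx : 0 < x) : logKernel (-x) = logKernel x + x := by
  have h1 := kernel_pos hx
  have h2 : 1 - Real.exp (-x) = (Real.exp x - 1) * Real.exp (-x) := by
    rw [sub_mul, ← Real.exp_add, add_neg_cancel, Real.exp_zero, one_mul]
  rw [logKernel_of_pos hx, logKernel, h2, abs_of_pos (by positivity),
    Real.log_mul h1.ne' (Real.exp_pos _).ne', Real.log_exp]
  ring

lemma tendsto_logKernel_neg : Tendsto (fun x => logKernel (-x)) atTop (𝓝 0) := by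
  have h1 : Tendsto (fun x => 1 - Real.exp (-x)) atTop (𝓝 1) := by
    simpa using Real.tendsto_exp_neg_atTop_nhds_zero.const_sub 1
  have h2 := (h1.log one_ne_zero).neg
  simpa [logKernel, Real.log_abs] using h2

/-- With `u = e^x - 1 ≥ x` the product is dominated by `|u log u|`, which is continuous and vanishes
at `u = 0`. -/
lemma tendsto_mul_logKernel : Tendsto (fun x => x * logKernel x) (𝓝[>] 0) (𝓝 0) := by
  have h1 : Continuous fun x : ℝ => |(Real.exp x - 1) * Real.log (Real.exp x - 1)| :=
    (Real.continuous_mul_log.comp (by fun_prop : Continuous fun x : ℝ => Real.exp x - 1)).abs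
  have h2 := (h1.tendsto 0).mono_left (nhdsWithin_le_nhds (s := Ioi 0))
  simp only [Real.exp_zero, sub_self, zero_mul, abs_zero] at h2
  refine squeeze_zero_norm' ?_ h2
  filter_upwards [self_mem_nhdsWithin] with x hx
  have hx0 : 0 < x := hx
  have := Real.add_one_le_exp x
  rw [logKernel_of_pos hx0, Real.norm_eq_abs, abs_mul, abs_mul, abs_neg, abs_of_pos hx0,
    abs_of_pos (kernel_pos hx0)]
  gcongr
  linarith

/-- The boundary term of the integration by parts that turns `li_1` into a function. -/
def liOneBoundary (f : 𝓢(ℝ, ℂ)) (x : ℝ) : ℂ :=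
  logKernel x * slide 1 f x - logKernel (-x) * slide 1 f (-x)

/-- The logarithmic singularity multiplies the difference `slide 1 f x - slide 1 f (-x)`, which is
`O(x)`. -/
lemma tendsto_liOneBoundary_zero (f : 𝓢(ℝ, ℂ)) :
    Tendsto (liOneBoundary f) (𝓝[>] 0) (𝓝 0) := by
  set C := cst 1 * nrm 1 f
  have h1 : Tendsto (fun x : ℝ => |x * logKernel x| * (C * (2 * (1 + x) ^ (expo 1 + 2))) +
      x * ∫ y, ‖f y‖) (𝓝[>] 0) (𝓝 0) := by
    have hc : Continuous fun x : ℝ => C * (2 * (1 + x) ^ (expo 1 + 2)) := by fun_prop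
    have hd : Continuous fun x : ℝ => x * ∫ y, ‖f y‖ := by fun_prop
    have := (tendsto_mul_logKernel.abs.mul ((hc.tendsto 0).mono_left nhdsWithin_le_nhds)).add
      ((hd.tendsto 0).mono_left nhdsWithin_le_nhds)
    simpa using this
  refine squeeze_zero_norm' ?_ h1
  filter_upwards [self_mem_nhdsWithin] with x hx
  have hx0 : 0 < x := hx
  have e : liOneBoundary f x =
      logKernel x * (slide 1 f x - slide 1 f (-x)) - x * slide 1 f (-x) := by
    rw [liOneBoundary, logKernel_neg hx0]; push_cast; ring
  rw [e]
  refine (norm_sub_le _ _).trans (add_le_add ?_ ?_)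
  · rw [norm_mul, Complex.norm_real, Real.norm_eq_abs]
    refine (mul_le_mul_of_nonneg_left (slide_sub 1 f hx0) (abs_nonneg _)).trans (le_of_eq ?_)
    rw [abs_mul, abs_of_pos hx0]
    ring
  · rw [norm_mul, Complex.norm_real, Real.norm_eq_abs, abs_of_pos hx0]
    exact mul_le_mul_of_nonneg_left (norm_slide_one_le f _) hx0.le

/-- The linear growth of `logKernel x` meets the quadratic decay of `slide 1 f x`; what remains
carries the factor `logKernel (-x)`, which tends to `0`. -/
lemma tendsto_liOneBoundary_atTop (f : 𝓢(ℝ, ℂ)) :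
    Tendsto (liOneBoundary f) atTop (𝓝 0) := by
  set C := cst 1 * nrm 1 f
  have h1 : Tendsto (fun x : ℝ => C * x⁻¹ + |logKernel (-x)| * ((∫ y, ‖f y‖) + C)) atTop
      (𝓝 0) := by
    have := (tendsto_inv_atTop_zero.const_mul C).add
      (tendsto_logKernel_neg.abs.mul_const ((∫ y, ‖f y‖) + C))
    simpa using this
  have hC : 0 ≤ C := mul_nonneg (cst_nonneg 1) (bnd_nonneg _ _ _)
  refine squeeze_zero_norm' ?_ h1
  filter_upwards [Ioi_mem_atTop 0] with x hx
  have hx0 : 0 < x := hx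
  have e : liOneBoundary f x = -(x * slide 1 f x) -
      logKernel (-x) * (slide 1 f (-x) - slide 1 f x) := by
    rw [liOneBoundary, logKernel_neg hx0]; push_cast; ring
  have hs := slide_decay 1 f hx0
  have hs1 : ‖slide 1 f x‖ ≤ C := hs.trans
    (mul_le_of_le_one_right hC (inv_le_one_of_one_le₀ (one_le_pow₀ (by linarith))))
  rw [e]
  refine (norm_sub_le _ _).trans (add_le_add ?_ ?_)
  · rw [norm_neg, norm_mul, Complex.norm_real, Real.norm_eq_abs, abs_of_pos hx0]
    calc x * ‖slide 1 f x‖ ≤ x * (C * ((1 + x) ^ 2)⁻¹) := by gcongr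
      _ ≤ x * (C * (x ^ 2)⁻¹) := by gcongr; linarith
      _ = C * x⁻¹ := by field_simp
  · rw [norm_mul, Complex.norm_real, Real.norm_eq_abs]
    gcongr
    exact (norm_sub_le _ _).trans (add_le_add (norm_slide_one_le f _) hs1)

/-- Once both integrals are folded onto `(0, ∞)`, the difference of the integrands is the derivative
of `liOneBoundary f`, whose limits at both ends are `0`. -/
lemma li_one (f : 𝓢(ℝ, ℂ)) : li 1 f = ∫ x : ℝ, ((logKernel x : ℝ) : ℂ) * f x := by
  have hL := integrable_logKernel_mul f
  have hL' : IntegrableOn (fun x : ℝ => (logKernel x : ℂ) * f x + (logKernel (-x) : ℂ) * f (-x))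
      (Ioi 0) := (hL.add hL.comp_neg).integrableOn
  rw [li_apply, liPairing_eq, integral_eq_integral_Ioi_add_neg hL, ← sub_eq_zero,
    ← integral_sub (fold_integrable 1 f) hL', ← sub_zero (0 : ℂ)]
  refine integral_Ioi_of_tendsto_nhdsGT (G := liOneBoundary f) (fun x hx => ?_)
    ((fold_integrable 1 f).sub hL') (tendsto_liOneBoundary_zero f) (tendsto_liOneBoundary_atTop f)
  have hx0 : x ≠ 0 := ne_of_gt hx
  have h1 := (hasDerivAt_logKernel hx0).ofReal_comp.mul (hasDerivAt_slide_one f x)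
  have h2 := ((hasDerivAt_logKernel (neg_ne_zero.2 hx0)).ofReal_comp.scomp x
    (hasDerivAt_neg x)).mul ((hasDerivAt_slide_one f (-x)).scomp x (hasDerivAt_neg x))
  refine (h1.sub h2).congr_deriv ?_
  simp only [fold, Complex.real_smul, Function.comp]
  push_cast
  ring


/-! ### Antiderivatives and derivatives of distributions given by functions -/

lemma exists_support_bound {f : ℝ → ℂ} (hf : HasCompactSupport f) :
    ∃ R : ℝ, 0 < R ∧ ∀ x, R ≤ |x| → f x = 0 := by
  obtain ⟨R, hR0, hR⟩ := hf.isCompact.isBounded.exists_pos_norm_lt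
  refine ⟨R, hR0, fun x hx => image_eq_zero_of_notMem_tsupport fun h => ?_⟩
  exact absurd (hR x h) (not_lt.2 hx)

lemma hasCompactSupport_D {f : 𝓢(ℝ, ℂ)} (hf : HasCompactSupport f) : HasCompactSupport (D f) :=
  HasCompactSupport.deriv hf

/-- The countable exceptional set accommodates primitives of `log|x|`, which need not be
differentiable at `0`. -/
lemma integral_mul_D {V v : ℝ → ℂ} (hV : Continuous V) (hv : LocallyIntegrable v) {s : Set ℝ}
    (hs : s.Countable) (hd : ∀ x ∉ s, HasDerivAt V (v x) x) {f : 𝓢(ℝ, ℂ)}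
    (hf : HasCompactSupport f) : ∫ x, V x * D f x = -∫ x, v x * f x := by
  have i1 : Integrable fun x => V x * D f x :=
    (hV.mul (D f).continuous).integrable_of_hasCompactSupport (hasCompactSupport_D hf).mul_left
  have i2 : Integrable fun x => v x * f x :=
    hv.integrable_smul_right_of_hasCompactSupport f.continuous hf
  obtain ⟨R₁, hR₁, h1⟩ := exists_support_bound hf
  obtain ⟨R₂, hR₂, h2⟩ := exists_support_bound (hasCompactSupport_D hf)
  set R := max R₁ R₂
  have hR : 0 < R := lt_max_of_lt_left hR₁
  have hsupp : Function.support (fun x => v x * f x + V x * D f x) ⊆ Ioc (-R) R := fun x hx => by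
    by_contra hc
    have hle : R ≤ |x| := by
      by_contra! h
      exact hc ⟨(abs_lt.1 h).1, (abs_lt.1 h).2.le⟩
    exact hx (by simp [h1 x ((le_max_left _ _).trans hle), h2 x ((le_max_right _ _).trans hle)])
  have key := integral_eq_of_hasDerivAt_off_countable_of_le (fun x => V x * f x)
    (fun x => v x * f x + V x * D f x) (by linarith : -R ≤ R) hs
    (hV.mul f.continuous).continuousOn
    (fun x hx => (hd x hx.2).mul (hasDerivAt_D f x)) (i2.add i1).intervalIntegrable
  rw [intervalIntegral.integral_eq_integral_of_support_subset hsupp, integral_add i2 i1,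
    h1 R ((le_max_left _ _).trans (le_abs_self _)),
    h1 (-R) ((le_max_left _ _).trans ((le_abs_self _).trans_eq (abs_neg _).symm))] at key
  linear_combination key

lemma exists_contDiff_antideriv {g : ℝ → ℂ} (hg : ContDiff ℝ ∞ g) :
    ∃ G : ℝ → ℂ, ContDiff ℝ ∞ G ∧ ∀ x, HasDerivAt G (g x) x := by
  have hd : ∀ x, HasDerivAt (fun x => ∫ y in (0 : ℝ)..x, g y) (g x) x := fun x =>
    intervalIntegral.integral_hasDerivAt_right (hg.continuous.intervalIntegrable _ _)
      (hg.continuous.stronglyMeasurableAtFilter _ _) hg.continuous.continuousAt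
  refine ⟨_, contDiff_infty_iff_deriv.2 ⟨fun x => (hd x).differentiableAt, ?_⟩, hd⟩
  rwa [funext fun x => (hd x).deriv]

/-- The primitive that vanishes to the left of the support also vanishes to its right, because the
total integral is zero. -/
lemma exists_D_eq {f : 𝓢(ℝ, ℂ)} (hf : HasCompactSupport f) (h0 : ∫ x, f x = 0) :
    ∃ g : 𝓢(ℝ, ℂ), HasCompactSupport g ∧ D g = f := by
  obtain ⟨R, hR, hfR⟩ := exists_support_bound hf
  obtain ⟨G, hG, hGd⟩ := exists_contDiff_antideriv (f.smooth ⊤)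
  have hint : ∀ a b, ∫ x in a..b, f x = G b - G a := fun a b =>
    intervalIntegral.integral_eq_sub_of_hasDerivAt (fun x _ => hGd x)
      (f.continuous.intervalIntegrable _ _)
  have hfull : ∀ b, R ≤ b → G b = G (-R) := fun b hb => by
    have hsupp : Function.support f ⊆ Ioc (-R) b := fun x hx => by
      by_contra hc
      refine hx (hfR x ?_)
      by_contra! h
      exact hc ⟨(abs_lt.1 h).1, (abs_lt.1 h).2.le.trans hb⟩
    have := hint (-R) b
    rw [intervalIntegral.integral_eq_integral_of_support_subset hsupp, h0] at this
    exact (sub_eq_zero.1 this.symm)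
  have hleft : ∀ b, b ≤ -R → G b = G (-R) := fun b hb => by
    have := hint b (-R)
    rw [intervalIntegral.integral_zero_ae] at this
    · exact (sub_eq_zero.1 this.symm).symm
    · refine .of_forall fun x hx => hfR x ?_
      rw [uIoc_of_le hb] at hx
      exact (le_abs.2 (Or.inr (by linarith [hx.2])))
  have hcs : HasCompactSupport fun x => G x - G (-R) := by
    refine HasCompactSupport.of_support_subset_isCompact (isCompact_Icc (a := -R) (b := R))
      fun x hx => ?_
    by_contra hc
    rw [mem_Icc, not_and_or, not_le, not_le] at hc
    exact hx (sub_eq_zero.2 (hc.elim (fun h => hleft x h.le) (fun h => hfull x h.le)))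
  refine ⟨hcs.toSchwartzMap (hG.sub contDiff_const), hcs, ?_⟩
  ext x
  exact ((hGd x).sub_const _).deriv

lemma exists_integral_eq_one : ∃ ρ : 𝓢(ℝ, ℂ), HasCompactSupport ρ ∧ ∫ x, ρ x = 1 := by
  let b : ContDiffBump (0 : ℝ) := ⟨1, 2, one_pos, one_lt_two⟩
  have hcs : HasCompactSupport fun x => ((b.normed volume x : ℝ) : ℂ) :=
    (b.hasCompactSupport_normed (μ := volume)).comp_left Complex.ofReal_zero
  refine ⟨hcs.toSchwartzMap (Complex.ofRealCLM.contDiff.comp b.contDiff_normed), hcs, ?_⟩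
  refine (integral_ofReal (𝕜 := ℂ) (f := fun x => b.normed volume x)).trans ?_
  rw [b.integral_normed]
  simp

/-- For a fixed `ρ` of integral one, `f - (∫ f) ρ` has integral zero, hence is some `D g`, and on `D
g` the value of `T` is dictated by `S`. Thus `T` is known up to its value on `ρ`. -/
lemma IsGivenBy.exists_antideriv {T S : 𝓢'(ℝ, ℂ)} (hTS : ∀ f, T (D f) = -S f) {V v : ℝ → ℂ}
    (hS : IsGivenBy S v) (hV : Continuous V) {s : Set ℝ} (hs : s.Countable)
    (hd : ∀ x ∉ s, HasDerivAt V (v x) x) : ∃ c : ℂ, IsGivenBy T fun x => V x + c := by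
  obtain ⟨ρ, hρ, hρ1⟩ := exists_integral_eq_one
  -- The constant is forced by testing on `ρ`.
  refine ⟨T ρ - ∫ x, V x * ρ x, (hV.add continuous_const).locallyIntegrable, fun f hf => ?_⟩
  have hiV : ∀ g : 𝓢(ℝ, ℂ), HasCompactSupport g → Integrable fun x => V x * g x := fun g hg =>
    (hV.mul g.continuous).integrable_of_hasCompactSupport hg.mul_left
  set I := ∫ x, f x with hI
  have hcs : HasCompactSupport (f - I • ρ : 𝓢(ℝ, ℂ)) :=
    hf.sub (hρ.smul_left (f := fun _ => I))
  obtain ⟨g, hg, hgD⟩ := exists_D_eq hcs (by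
    calc ∫ x, (f - I • ρ : 𝓢(ℝ, ℂ)) x = ∫ x, (f x - I * ρ x) := rfl
      _ = 0 := by
        rw [integral_sub f.integrable (ρ.integrable.const_mul I), integral_const_mul, hρ1, ← hI,
          mul_one, sub_self])
  have h1 : T f = T (D g) + I * T ρ := by
    rw [hgD, map_sub, map_smul, smul_eq_mul, sub_add_cancel]
  have h2 : ∫ x, V x * D g x = (∫ x, V x * f x) - I * ∫ x, V x * ρ x := by
    rw [← integral_const_mul, ← integral_sub (hiV f hf) ((hiV ρ hρ).const_mul I), hgD]
    congr 1
    ext x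
    change V x * (f x - I * ρ x) = _
    ring
  simp only [add_mul]
  rw [integral_add (hiV f hf) (f.integrable.const_mul _), integral_const_mul, ← hI, h1, hTS,
    hS.2 g hg, ← integral_mul_D hV hS.1 hs hd hg, h2]
  ring

lemma IsGivenBy.deriv {T S : 𝓢'(ℝ, ℂ)} (hTS : ∀ f, T (D f) = -S f) {V : ℝ → ℂ}
    (hT : IsGivenBy T V) (hV : ContDiff ℝ ∞ V) : IsGivenBy S (deriv V) := by
  obtain ⟨h1, h2⟩ := contDiff_infty_iff_deriv.1 hV
  refine ⟨h2.continuous.locallyIntegrable, fun f hf => ?_⟩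
  have h := integral_mul_D hV.continuous h2.continuous.locallyIntegrable countable_empty
    (fun x _ => (h1 x).hasDerivAt) hf
  rw [← hT.2 _ (hasCompactSupport_D hf), hTS] at h
  exact neg_injective h

/-! ### The singularities of `li_{-n}` and `li_n` -/

/-- The difference of `li_{-n}` and its singular part. -/
def negRem (n : ℕ) : 𝓢'(ℝ, ℂ) :=
  li (-(n : ℂ)) - ((-1 : ℂ) ^ ((n : ℤ) - 1) * (n.factorial : ℂ)) • invPow (n + 1)

lemma negRem_apply (n : ℕ) (f : 𝓢(ℝ, ℂ)) : negRem n f =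
    li (-(n : ℂ)) f - ((-1 : ℂ) ^ ((n : ℤ) - 1) * (n.factorial : ℂ)) * invPow (n + 1) f := rfl

/-- The factor `n + 1` from `invPow_D` completes the factorial and its sign flips `(-1)^(n-1)`; the
exponent is an integer, so `n = 0` gives `-1`. -/
lemma negRem_D (n : ℕ) (f : 𝓢(ℝ, ℂ)) : negRem n (D f) = -negRem (n + 1) f := by
  have h1 : -(n : ℂ) - 1 = -((n + 1 : ℕ) : ℂ) := by push_cast; ring
  have h2 : (-1 : ℂ) ^ (((n + 1 : ℕ) : ℤ) - 1) = -(-1 : ℂ) ^ ((n : ℤ) - 1) := by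
    rw [show ((n + 1 : ℕ) : ℤ) - 1 = (n : ℤ) - 1 + 1 by push_cast; ring,
      zpow_add_one₀ (by norm_num)]
    ring
  rw [negRem_apply, negRem_apply, li_D, invPow_D, h1, h2, Nat.factorial_succ]
  push_cast
  ring

lemma isGivenBy_negRem_zero : IsGivenBy (negRem 0) fun x => (pvRem x : ℂ) := by
  have hc : Continuous fun x => (pvRem x : ℂ) :=
    Complex.continuous_ofReal.comp contDiff_pvRem.continuous
  refine ⟨hc.locallyIntegrable, fun f hf => ?_⟩
  have hi : Integrable fun x => (pvRem x : ℂ) * f x :=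
    (hc.mul f.continuous).integrable_of_hasCompactSupport hf.mul_left
  rw [negRem_apply, integral_eq_integral_Ioi_add_neg hi, li_apply, liPairing_eq, invPow_apply,
    invPowPairing, Nat.cast_zero, neg_zero, ← integral_const_mul,
    ← integral_sub (fold_integrable 0 f) ((invPow_bound 1 f).1.const_mul _)]
  -- The folded integrands agree pointwise: for `m = 1` the Taylor terms `f 0` at `x` and `-x`
  -- cancel.
  refine setIntegral_congr_fun measurableSet_Ioi fun x hx => ?_
  have hx0 : x ≠ 0 := ne_of_gt hx
  have hxc : (x : ℂ) ≠ 0 := by exact_mod_cast hx0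
  simp only [fold, slide_zero, pvRem_of_ne hx0, pvRem_of_ne (neg_ne_zero.2 hx0), taylorRem]
  simp
  field_simp
  ring

lemma exists_isGivenBy_negRem (n : ℕ) : ∃ g : ℝ → ℂ, ContDiff ℝ ∞ g ∧ IsGivenBy (negRem n) g := by
  induction n with
  | zero => exact ⟨_, Complex.ofRealCLM.contDiff.comp contDiff_pvRem, isGivenBy_negRem_zero⟩
  | succ n ih =>
    obtain ⟨g, hg, h⟩ := ih
    exact ⟨deriv g, (contDiff_infty_iff_deriv.1 hg).2, h.deriv (negRem_D n) hg⟩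

/-! ### Positive orders: primitives of the logarithmic singularity. -/

lemma locallyIntegrable_logKernel : LocallyIntegrable fun x => (logKernel x : ℂ) := by
  have h1 : LocallyIntegrable fun x => (Icc (-1) 1).indicator (fun y : ℝ => |Real.log y|) x +
      2 * |x| :=
    integrable_indicator_abs_log.locallyIntegrable.add
      (by fun_prop : Continuous fun x : ℝ => 2 * |x|).locallyIntegrable
  refine h1.mono ?_ (.of_forall fun x => ?_)
  · have := measurable_logKernel
    exact Measurable.aestronglyMeasurable (by fun_prop)
  · rw [Complex.norm_real, Real.norm_eq_abs]
    refine le_trans ?_ (le_abs_self _)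
    linarith [abs_logKernel_le x, abs_log_le_indicator_add x]

/-- The singular part of `li_{n+1}`. -/
def logSing (n : ℕ) (x : ℝ) : ℝ := -(x ^ n * Real.log |x|) / (n ! : ℝ)

/-- One factor `x` tames the logarithm. Without it continuity fails, so the induction on the order
starts from the explicit formula for `li_1`. -/
lemma continuous_logSing (n : ℕ) : Continuous (logSing (n + 1)) := by
  have h : logSing (n + 1) = fun x => -(x ^ n * (x * Real.log x)) / ((n + 1)! : ℝ) := by
    ext x
    rw [logSing, Real.log_abs]
    ring
  have := Real.continuous_mul_log
  rw [h]
  fun_prop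

lemma hasDerivAt_logSing (n : ℕ) {x : ℝ} (hx : x ≠ 0) :
    HasDerivAt (logSing (n + 1)) (logSing n x - x ^ n / ((n + 1)! : ℝ)) x := by
  have h := (((hasDerivAt_pow (n + 1) x).mul (Real.hasDerivAt_log hx)).neg).div_const
    ((n + 1)! : ℝ)
  refine (h.congr_of_eventuallyEq (.of_forall fun y => ?_)).congr_deriv ?_
  · simp [logSing]
  · have h1 : (n ! : ℝ) ≠ 0 := by exact_mod_cast Nat.factorial_ne_zero n
    rw [logSing, Real.log_abs, Nat.factorial_succ]
    push_cast
    field_simp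
    ring

lemma exists_isGivenBy_li (n : ℕ) : ∃ g : ℝ → ℂ, ContDiff ℝ ∞ g ∧
    IsGivenBy (li ((n + 1 : ℕ) : ℂ)) fun x => (logSing n x : ℂ) + g x := by
  induction n with
  | zero =>
    refine ⟨fun x => ((-Real.log (expQuot x) : ℝ) : ℂ),
      Complex.ofRealCLM.contDiff.comp contDiff_log_expQuot.neg, ?_⟩
    have e : (fun x => (logSing 0 x : ℂ) + ((-Real.log (expQuot x) : ℝ) : ℂ)) =
        fun x => (logKernel x : ℂ) := by
      ext x
      rw [logKernel, log_abs_one_sub_exp, logSing]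
      simp
      ring
    rw [e]
    exact ⟨locallyIntegrable_logKernel, fun f _ => by simpa using li_one f⟩
  | succ n ih =>
    obtain ⟨g, hg, h⟩ := ih
    -- The added monomial compensates the term `-x^n / (n+1)!` in the derivative of `logSing (n +
    -- 1)`.
    obtain ⟨G, hG, hGd⟩ := exists_contDiff_antideriv (g := fun x =>
      g x + ((x ^ n / ((n + 1)! : ℝ) : ℝ) : ℂ))
      (hg.add (Complex.ofRealCLM.contDiff.comp ((contDiff_id.pow n).div_const _)))
    have hD : ∀ f, li ((n + 1 + 1 : ℕ) : ℂ) (D f) = -li ((n + 1 : ℕ) : ℂ) f := fun f => by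
      rw [li_D]
      push_cast
      rw [add_sub_cancel_right]
    obtain ⟨c, hc⟩ := h.exists_antideriv hD (V := fun x => (logSing (n + 1) x : ℂ) + G x)
      ((Complex.continuous_ofReal.comp (continuous_logSing n)).add hG.continuous)
      (countable_singleton 0) (fun x hx => by
        refine ((hasDerivAt_logSing n hx).ofReal_comp.add (hGd x)).congr_deriv ?_
        push_cast
        ring)
    exact ⟨fun x => G x + c, hG.add contDiff_const, by simpa only [add_assoc] using hc⟩


end

end Polylog

theorem mainTheorem3 :
    (∀ n : ℕ, ∃ g : ℝ → ℂ, ContDiff ℝ ∞ g ∧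
      Polylog.IsGivenBy
        (Polylog.li (-(n : ℂ)) -
          ((-1 : ℂ) ^ ((n : ℤ) - 1) * (n.factorial : ℂ)) • Polylog.invPow (n + 1)) g) ∧
    (∀ n : ℕ, 0 < n → ∃ g : ℝ → ℂ, ContDiff ℝ ∞ g ∧
      Polylog.IsGivenBy (Polylog.li (n : ℂ))
        (fun x => ((-(x ^ (n - 1) * Real.log |x|) / ((n - 1).factorial : ℝ) : ℝ) : ℂ) + g x)) ∧
    (∀ f : 𝓢(ℝ, ℂ),
      Integrable (fun x : ℝ => ((-Real.log |1 - Real.exp x| : ℝ) : ℂ) * f x) ∧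
      Polylog.li 1 f = ∫ x : ℝ, ((-Real.log |1 - Real.exp x| : ℝ) : ℂ) * f x) := by
  refine ⟨Polylog.exists_isGivenBy_negRem, fun n hn => ?_, fun f =>
    ⟨Polylog.integrable_logKernel_mul f, Polylog.li_one f⟩⟩
  obtain ⟨k, rfl⟩ := Nat.exists_eq_add_one_of_ne_zero hn.ne'
  -- `k + 1 - 1` reduces to `k`, so the stated singular part is `logSing k` by definition.
  exact Polylog.exists_isGivenBy_li k
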